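/- There are absolute constants $C,c>0$ such that the following holds. Let $d\ge 3$, let $A\in\mathbb{R}^{d\times d}$ be symmetric positive semidefinite with eigenvalues $1\ge\lambda_1>\lambda_2>\lambda_3\ge\cdots\ge\lambda_d\ge 0$ and associated orthonormal eigenvectors $v_1,\dots,v_d$, and let $\alpha_1,\alpha_2>0$ satisfy $\alpha_1\le\lambda_1-\lambda_2$ and $\alpha_2\le\lambda_2-\lambda_3$. Let $0<\rho<\min\{1/2,\sqrt{\alpha_1}\}$, $\tau>1$ and $\delta=\min\{\rho,\tfrac{1}{\tau\sqrt d}\}$. Let $q_0,w_0$ be independent and uniformly distributed on the unit sphere of $\mathbb{R}^d$, and let $\theta_0=\arccos|q_0^\top v_1|$. *Pre-momentum phase.* For $j\ge1$ put $$q_j=\frac{Aq_{j-1}}{\|Aq_{j-1}\|},\qquad \nu_j=q_j^\top Aq_j,\qquad w_j=\frac{(A-\nu_jq_jq_j^\top)w_{j-1}}{\|(A-\nu_jq_jq_j^\top)w_{j-1}\|},$$ and let $\mu_j=w_j^\top Aw_j$ for $j\ge 0$. *Momentum phase after $J$ pre-momentum steps.* Put $\beta=\mu_J^2/4$, $x_{-1}=0$,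 $x_0=q_J$, and $x_{k+1}=\dfrac{Ax_k-\beta x_{k-1}}{\|Ax_k-\beta x_{k-1}\|}$ for $k\ge0$. Then, with all but probability at most $\tau^{-c}+e^{-cd}$ over $(q_0,w_0)$, the following holds for every integer $J\ge 0$ with $$J\ \ge\ C\Bigl(\frac1{\alpha_1}\log\frac{\tan^2\theta_0}{\delta\alpha_2}+\frac1{\alpha_2}\log\frac{d\tau}{\rho}\Bigr):$$ $|\lambda_2-\mu_J|<\rho^2$, and the momentum phase converges, that is, $\sin^2\theta(x_k,v_1)=1-(x_k^\top v_1)^2\to0$ as $k\to\infty$. -/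

import Mathlib

open MeasureTheory Filter Topology

noncomputable section

namespace DMPower

/-- Column vectors in `ℝ^d` with the Euclidean norm. -/
abbrev Vec (d : ℕ) : Type := EuclideanSpace ℝ (Fin d)

/-- The unit sphere of `ℝ^d`. -/
abbrev UnitSphere (d : ℕ) : Type := Metric.sphere (0 : Vec d) 1

/-- The uniform distribution on the unit sphere of `ℝ^d`: the surface measure divided by its
total mass. -/
def uniformSphere (d : ℕ) : Measure (UnitSphere d) :=
  ((volume : Measure (Vec d)).toSphere Set.univ)⁻¹ • (volume : Measure (Vec d)).toSphere

instance uniformSphere_isProbabilityMeasure (d : ℕ) [NeZero d] :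
    IsProbabilityMeasure (uniformSphere d) := by
  constructor
  have h0 : (volume : Measure (Vec d)).toSphere Set.univ ≠ 0 := by
    rw [Ne, Measure.measure_univ_eq_zero]
    exact Measure.toSphere_ne_zero _
  simp only [uniformSphere, Measure.smul_apply, smul_eq_mul]
  exact ENNReal.inv_mul_cancel h0 (measure_ne_top _ _)

/-- The quadratic form `xᵀ A x`; the Rayleigh quotient of `A` at a unit vector `x`. -/
def rayleigh {d : ℕ} (A : Matrix (Fin d) (Fin d) ℝ) (x : Vec d) : ℝ :=
  inner ℝ x (A.toEuclideanLin x)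

/-- The inexact deflation `A - P` of `A`, where `P = ν q qᵀ` and `ν = qᵀ A q`. -/
def deflate {d : ℕ} (A : Matrix (Fin d) (Fin d) ℝ) (q : Vec d) : Matrix (Fin d) (Fin d) ℝ :=
  A - rayleigh A q • Matrix.vecMulVec (q : Fin d → ℝ) (q : Fin d → ℝ)

/-- The pair `(q_j, w_j)` after `j` steps of the pre-momentum phase started at `(q₀, w₀)`:
first `q_j = A q_{j-1} / ‖A q_{j-1}‖`, and then
`w_j = (A - ν_j q_j q_jᵀ) w_{j-1} / ‖(A - ν_j q_j q_jᵀ) w_{j-1}‖`. -/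
def preMomentum {d : ℕ} (A : Matrix (Fin d) (Fin d) ℝ) (q₀ w₀ : Vec d) : ℕ → Vec d × Vec d
  | 0 => (q₀, w₀)
  | j + 1 =>
    let s := preMomentum A q₀ w₀ j
    let q := NormedSpace.normalize (A.toEuclideanLin s.1)
    (q, NormedSpace.normalize ((deflate A q).toEuclideanLin s.2))

/-- The estimate `μ_j = w_jᵀ A w_j` of the second eigenvalue after `j` pre-momentum steps. -/
def secondEstimate {d : ℕ} (A : Matrix (Fin d) (Fin d) ℝ) (q₀ w₀ : Vec d) (j : ℕ) : ℝ :=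
  rayleigh A (preMomentum A q₀ w₀ j).2

/-- Two consecutive iterates of the power method with momentum coefficient `β`, started with the
previous iterate `0` and the current iterate `p`. -/
def momentumPair {d : ℕ} (A : Matrix (Fin d) (Fin d) ℝ) (β : ℝ) (p : Vec d) :
    ℕ → Vec d × Vec d
  | 0 => (0, p)
  | k + 1 =>
    let s := momentumPair A β p k
    (s.2, NormedSpace.normalize (A.toEuclideanLin s.2 - β • s.1))

/-- The current vector after `k` steps of the momentum phase that follows `J` pre-momentum steps:
it starts at `q_J` and uses the momentum coefficient `β = μ_J² / 4`. -/
def momentumPhase {d : ℕ} (A : Matrix (Fin d) (Fin d) ℝ) (q₀ w₀ : Vec d) (J k : ℕ) : Vec d :=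
  (momentumPair A ((secondEstimate A q₀ w₀ J) ^ 2 / 4) (preMomentum A q₀ w₀ J).1 k).2

/-- `sin² θ(q, v) = 1 - (qᵀ v)²` for unit vectors `q`, `v`. -/
def sinSq {d : ℕ} (q v : Vec d) : ℝ := 1 - (inner ℝ q v) ^ 2

/-- The angle `θ₀ = arccos |q₀ᵀ v|`. -/
def angle {d : ℕ} (q₀ v : Vec d) : ℝ := Real.arccos |inner ℝ q₀ v|

end DMPower

end

/-! With a = ⟨v₁, q₀⟩, split w₀ = g + ζ q₀ where g ⊥ v₁. Since A q_{j-1} is parallel to q_j, inexact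
deflation preserves this shape: the unnormalized w_j equals A^j g + z_j q_j
(`rawSecond_decomposition`). By `deflate_step` each new coefficient carries the factor s_j, a bound
for the sine of the angle between q_j and v₁, and power iteration gives s_j ≤ tan θ₀ · κ^j with κ =
λ₂/λ₁. Relative to λ₂^j the coefficient may grow at first, but it is eventually damped to order s_J
(`damped_recursion`). What remains is A^J g, power iteration inside v₁^⊥, which aligns with v₂ at
rate e^{-α₂ J}. Hence the Rayleigh quotient μ_J is within ρ² of λ₂ (`abs_sub_secondEstimate_mul_le`,
`rate_bounds`).

As ρ² < α₁ ≤ λ₁ - λ₂, this forces μ_J ≤ λ₁, so β ≤ λ₁²/4. In the momentum phase the ratio z of the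
i-th coordinate to the first satisfies (1 - s) z⁺ = κ_i z - s z₋, with κ_i = λ_i/λ₁ and s varying in
[0, 7/25]. A Lyapunov function contracts it uniformly (`heavyBallEnergy_step`,
`momentumPair_tendsto`).

The starting vectors must avoid three events: a small; the v₂ coordinate of a g, which is a linear
form in w₀, small; and q₀ so close to ±v₁ that the logarithm in the threshold for J gives too few
steps. Volume comparisons bound these events (`volume_slab_le`, `volume_cone_le`), and
`min_one_failure_le` absorbs the constants. -/

namespace DMPower

/-! ### Slabs and caps under the uniform measure on the sphere. -/

section SphereMeasure
open scoped Pointwise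

/-- `toSphere` of a set is d times the volume of the cone over it, so normalized surface measure is
a ratio of volumes in the unit ball. -/
lemma uniformSphere_le_of_cone {d : ℕ} [NeZero d] {s : Set (UnitSphere d)} (hs : MeasurableSet s)
    {S : Set (Vec d)} (hS : ∀ x ∈ s, ∀ r : ℝ, 0 < r → r < 1 → r • (x : Vec d) ∈ S)
    {c : ENNReal} (h : volume S ≤ c * volume (Metric.ball (0 : Vec d) 1)) :
    uniformSphere d s ≤ c := by
  have hsub : Set.Ioo (0 : ℝ) 1 • (Subtype.val '' s) ⊆ S := by
    rintro _ ⟨r, hr, _, ⟨x, hx, rfl⟩, rfl⟩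
    exact hS x hx r hr.1 hr.2
  have h0 : (volume : Measure (Vec d)).toSphere Set.univ ≠ 0 := by
    rw [Ne, Measure.measure_univ_eq_zero]
    exact Measure.toSphere_ne_zero _
  have h1 : (volume : Measure (Vec d)).toSphere Set.univ ≠ ⊤ := measure_ne_top _ _
  have h2 : (volume : Measure (Vec d)).toSphere s ≤
      c * (volume : Measure (Vec d)).toSphere Set.univ := by
    rw [Measure.toSphere_apply' _ hs, Measure.toSphere_apply_univ, mul_left_comm]
    gcongr
    exact (measure_mono hsub).trans h
  simp only [uniformSphere, Measure.smul_apply, smul_eq_mul]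
  calc _ ≤ ((volume : Measure (Vec d)).toSphere Set.univ)⁻¹ *
        (c * (volume : Measure (Vec d)).toSphere Set.univ) := by gcongr
    _ = c := by
      rw [mul_left_comm, ENNReal.inv_mul_cancel h0 h1, mul_one]

lemma half_le_one_sub_pow {d : ℕ} (hd : 0 < d) : (1 / 2 : ℝ) ≤ (1 - 1 / (2 * d)) ^ d := by
  have hd' : (1 : ℝ) ≤ d := by exact_mod_cast hd
  have h1 : 1 / (2 * (d : ℝ)) ≤ 1 := by
    rw [div_le_one (by positivity)]; linarith
  have h := one_add_mul_le_pow (a := -(1 / (2 * (d : ℝ)))) (by linarith) d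
  have h2 : (d : ℝ) * -(1 / (2 * (d : ℝ))) = -(1 / 2) := by field_simp
  rw [h2] at h
  calc (1 / 2 : ℝ) = 1 + -(1 / 2) := by norm_num
    _ ≤ _ := h
    _ = _ := by ring

/-- A packing argument: shrink the slab by m = 1 - 1/(2d) and translate it along b by multiples of
its width 2t. The N copies are disjoint and stay in the ball, since the shifts total at most 1/(2d).
Shrinking costs only m^d ≥ 1/2. -/
lemma volume_slab_le {d N : ℕ} [NeZero d] (hN : 0 < N) {b : Vec d} (hb : ‖b‖ = 1) :
    volume {x : Vec d | ‖x‖ < 1 ∧ |inner ℝ b x| < 1 / (4 * d * N)} ≤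
      ENNReal.ofReal (2 / N) * volume (Metric.ball (0 : Vec d) 1) := by
  set t : ℝ := 1 / (4 * d * N) with ht
  set S := {x : Vec d | ‖x‖ < 1 ∧ |inner ℝ b x| < t} with hSdef
  have hd : 0 < d := Nat.pos_of_ne_zero (NeZero.ne d)
  have hd' : (1 : ℝ) ≤ d := by exact_mod_cast hd
  have hN' : (0 : ℝ) < N := by exact_mod_cast hN
  have ht0 : 0 < t := by positivity
  set m : ℝ := 1 - 1 / (2 * d) with hm
  have hm1 : m < 1 := by
    have : 0 < 1 / (2 * (d : ℝ)) := by positivity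
    linarith
  have hm0 : 0 < m := by
    have : 1 / (2 * (d : ℝ)) ≤ 1 / 2 := by gcongr; linarith
    linarith
  have hSm : MeasurableSet S := by
    have h1 : Measurable fun x : Vec d => |inner ℝ b x| := by fun_prop
    exact (measurableSet_lt measurable_norm measurable_const).inter
      (measurableSet_lt h1 measurable_const)
  let F : ℕ → Set (Vec d) := fun k => (k * (2 * t)) • b +ᵥ (m • S)
  have hvol : ∀ k, volume (F k) = ENNReal.ofReal (m ^ d) * volume S := by
    intro k
    simp only [F, measure_vadd, Measure.addHaar_smul, finrank_euclideanSpace, Fintype.card_fin]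
    rw [abs_of_nonneg (by positivity)]
  have hmem : ∀ k x, x ∈ F k → ∃ y ∈ S, x = (k * (2 * t)) • b + m • y := by
    rintro k x ⟨_, ⟨y, hy, rfl⟩, rfl⟩
    exact ⟨y, hy, rfl⟩
  have hbb : inner ℝ b b = (1 : ℝ) := by rw [real_inner_self_eq_norm_sq, hb]; norm_num
  have hslab : ∀ k x, x ∈ F k → |inner ℝ b x - k * (2 * t)| < t := by
    intro k x hx
    obtain ⟨y, hy, rfl⟩ := hmem k x hx
    rw [inner_add_right, inner_smul_right, inner_smul_right, hbb, mul_one, add_sub_cancel_left,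
      abs_mul, abs_of_pos hm0]
    nlinarith [hy.2, abs_nonneg (inner ℝ b y)]
  have hdisj : ((Finset.range N : Finset ℕ) : Set ℕ).PairwiseDisjoint F := by
    intro k _ l _ hkl
    refine Set.disjoint_left.2 fun x hx hx' => hkl ?_
    have h1 := abs_lt.1 (hslab k x hx)
    have h2 := abs_lt.1 (hslab l x hx')
    have h3 : (k : ℝ) < l + 1 := by
      by_contra h
      push Not at h
      nlinarith
    have h4 : (l : ℝ) < k + 1 := by
      by_contra h
      push Not at h
      nlinarith
    norm_cast at h3 h4
    omega
  have hmeas : ∀ k ∈ Finset.range N, MeasurableSet (F k) := fun k _ =>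
    (hSm.const_smul₀ m).const_vadd _
  have hsub : (⋃ k ∈ Finset.range N, F k) ⊆ Metric.ball (0 : Vec d) 1 := by
    intro x hx
    simp only [Set.mem_iUnion, Finset.mem_range] at hx
    obtain ⟨k, hk, hx⟩ := hx
    obtain ⟨y, hy, rfl⟩ := hmem k x hx
    rw [mem_ball_zero_iff]
    have hk' : (k : ℝ) ≤ N := by exact_mod_cast hk.le
    have h1 : (k : ℝ) * (2 * t) ≤ 1 / (2 * d) := by
      calc (k : ℝ) * (2 * t) ≤ N * (2 * t) := by gcongr
        _ = 1 / (2 * d) := by rw [ht]; field_simp; norm_num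
    calc _ ≤ ‖((k : ℝ) * (2 * t)) • b‖ + ‖m • y‖ := norm_add_le _ _
      _ = k * (2 * t) + m * ‖y‖ := by
        rw [norm_smul, norm_smul, hb, Real.norm_of_nonneg (by positivity),
          Real.norm_of_nonneg hm0.le, mul_one]
      _ < 1 / (2 * d) + m := by nlinarith [hy.1, norm_nonneg y]
      _ = 1 := by rw [hm]; ring
  have hsum : (N : ENNReal) * (ENNReal.ofReal (m ^ d) * volume S) ≤
      volume (Metric.ball (0 : Vec d) 1) := by
    calc _ = ∑ k ∈ Finset.range N, volume (F k) := by simp [hvol]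
      _ = volume (⋃ k ∈ Finset.range N, F k) := (measure_biUnion_finset hdisj hmeas).symm
      _ ≤ _ := measure_mono hsub
  have hone : (1 : ENNReal) ≤ ENNReal.ofReal (2 / N) * (N * ENNReal.ofReal (m ^ d)) := by
    rw [← ENNReal.ofReal_natCast, ← ENNReal.ofReal_mul (by positivity),
      ← ENNReal.ofReal_mul (by positivity), ENNReal.one_le_ofReal]
    have := half_le_one_sub_pow hd
    rw [← hm] at this
    calc (1 : ℝ) ≤ 2 * m ^ d := by linarith
      _ = _ := by field_simp
  calc volume S = 1 * volume S := (one_mul _).symm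
    _ ≤ (ENNReal.ofReal (2 / N) * (N * ENNReal.ofReal (m ^ d))) * volume S := by gcongr
    _ = ENNReal.ofReal (2 / N) * (N * (ENNReal.ofReal (m ^ d) * volume S)) := by ring
    _ ≤ _ := by gcongr

lemma uniformSphere_slab_le {d N : ℕ} [NeZero d] (hN : 0 < N) (b : Vec d) :
    uniformSphere d {x | |inner ℝ b (x : Vec d)| < 1 / (4 * d * N) * ‖b‖} ≤
      ENNReal.ofReal (2 / N) := by
  by_cases hb : b = 0
  · simp [hb]
  have hb' : 0 < ‖b‖ := norm_pos_iff.2 hb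
  refine uniformSphere_le_of_cone (measurableSet_lt (by fun_prop) measurable_const) ?_
    (volume_slab_le hN (b := ‖b‖⁻¹ • b) (by rw [norm_smul]; simp [hb'.ne']))
  intro x hx r hr0 hr1
  have hx1 : ‖(x : Vec d)‖ = 1 := by simp
  refine ⟨by rw [norm_smul, hx1, Real.norm_of_nonneg hr0.le]; linarith, ?_⟩
  rw [Set.mem_ofPred_eq] at hx
  rw [inner_smul_left, inner_smul_right]
  simp only [conj_trivial]
  rw [abs_mul, abs_mul, abs_of_pos hr0, abs_of_pos (inv_pos.2 hb')]
  have h1 : ‖b‖⁻¹ * |inner ℝ b (x : Vec d)| < 1 / (4 * d * N) := by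
    rw [inv_mul_lt_iff₀ hb']; linarith
  have h2 : 0 ≤ ‖b‖⁻¹ * |inner ℝ b (x : Vec d)| := by positivity
  nlinarith

/-- Scaling the axis by m = √(1/2) and the other directions by M = √(1/(2ε)) still maps the cone
into the ball. The determinant is m M^(d-1) ≥ m M² because d ≥ 3 and M ≥ 1, which makes the bound
linear in ε. -/
lemma volume_cone_le {d : ℕ} (hd : 3 ≤ d) (v : OrthonormalBasis (Fin d) ℝ (Vec d)) (i₀ : Fin d)
    {ε : ℝ} (hε : 0 < ε) (hε' : 2 * ε ≤ 1) :
    volume {x : Vec d | ‖x‖ < 1 ∧ ‖x‖ ^ 2 - inner ℝ (v i₀) x ^ 2 < ε * ‖x‖ ^ 2} ≤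
      ENNReal.ofReal (2 * √2 * ε) * volume (Metric.ball (0 : Vec d) 1) := by
  set S := {x : Vec d | ‖x‖ < 1 ∧ ‖x‖ ^ 2 - inner ℝ (v i₀) x ^ 2 < ε * ‖x‖ ^ 2}
  set M : ℝ := √(1 / (2 * ε))
  have hMsq : M ^ 2 = 1 / (2 * ε) := Real.sq_sqrt (by positivity)
  have hM : 1 ≤ M := Real.one_le_sqrt.2 (by rw [le_div_iff₀ (by positivity)]; linarith)
  set m : ℝ := √(1 / 2)
  have hmsq : m ^ 2 = 1 / 2 := Real.sq_sqrt (by positivity)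
  have hm : 0 < m := Real.sqrt_pos.2 (by norm_num)
  let D : Fin d → ℝ := fun i => if i = i₀ then m else M
  let f := Matrix.toLin v.toBasis v.toBasis (Matrix.diagonal D)
  have hfv : ∀ i, f (v i) = D i • v i := by
    intro i
    have := Matrix.toLin_self v.toBasis v.toBasis (Matrix.diagonal D) i
    simpa [Matrix.diagonal_apply, ite_smul, Finset.sum_ite_eq'] using this
  have hfc : ∀ i x, inner ℝ (v i) (f x) = D i * inner ℝ (v i) x := by
    intro i x
    conv_lhs => rw [← v.sum_repr' x]
    simp only [map_sum, map_smul, hfv, inner_sum, inner_smul_right, v.inner_eq_ite]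
    simp [mul_comm]
  have hnorm : ∀ x : Vec d, ‖x‖ ^ 2 = inner ℝ (v i₀) x ^ 2 +
      ∑ i ∈ Finset.univ.erase i₀, inner ℝ (v i) x ^ 2 := by
    intro x
    rw [Finset.add_sum_erase _ (fun i => inner ℝ (v i) x ^ 2) (Finset.mem_univ i₀),
      ← v.sum_sq_norm_inner_right x]
    simp
  have hdet : LinearMap.det f = m * M ^ (d - 1) := by
    rw [LinearMap.det_toLin, Matrix.det_diagonal, ← Finset.mul_prod_erase _ _ (Finset.mem_univ i₀)]
    simp only [D, if_true]
    rw [Finset.prod_congr rfl (g := fun _ => M) (fun i hi => if_neg (Finset.ne_of_mem_erase hi))]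
    simp
  have hsub : f '' S ⊆ Metric.ball 0 1 := by
    rintro _ ⟨x, hx, rfl⟩
    rw [mem_ball_zero_iff]
    have h1 : ‖f x‖ ^ 2 = 1 / 2 * inner ℝ (v i₀) x ^ 2 +
        1 / (2 * ε) * (‖x‖ ^ 2 - inner ℝ (v i₀) x ^ 2) := by
      rw [hnorm (f x), hnorm x, add_sub_cancel_left, Finset.mul_sum]
      congr 1
      · simp [hfc, D, mul_pow, hmsq]
      · refine Finset.sum_congr rfl fun i hi => ?_
        simp [hfc, D, mul_pow, hMsq, Finset.ne_of_mem_erase hi]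
    have h2 : inner ℝ (v i₀) x ^ 2 ≤ ‖x‖ ^ 2 := by
      rw [hnorm x]
      have : 0 ≤ ∑ i ∈ Finset.univ.erase i₀, inner ℝ (v i) x ^ 2 :=
        Finset.sum_nonneg fun i _ => sq_nonneg _
      linarith
    have h3 : 1 / (2 * ε) * (‖x‖ ^ 2 - inner ℝ (v i₀) x ^ 2) < 1 / 2 * ‖x‖ ^ 2 := by
      calc _ < 1 / (2 * ε) * (ε * ‖x‖ ^ 2) := by
            gcongr; exact hx.2
        _ = _ := by field_simp
    have h4 : ‖x‖ < 1 := hx.1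
    nlinarith [norm_nonneg x, norm_nonneg (f x)]
  have hvol : ENNReal.ofReal (m * M ^ (d - 1)) * volume S ≤ volume (Metric.ball (0 : Vec d) 1) := by
    have h := measure_mono (μ := volume) hsub
    rw [Measure.addHaar_image_linearMap, hdet, abs_of_nonneg (by positivity)] at h
    exact h
  have hone : (1 : ENNReal) ≤ ENNReal.ofReal (2 * √2 * ε) * ENNReal.ofReal (m * M ^ (d - 1)) := by
    rw [← ENNReal.ofReal_mul (by positivity), ENNReal.one_le_ofReal]
    have h1 : M ^ 2 ≤ M ^ (d - 1) := pow_le_pow_right₀ hM (by omega)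
    have h2 : √2 * m = 1 := by
      rw [← Real.sqrt_mul (by norm_num)]; norm_num
    calc (1 : ℝ) = 2 * √2 * ε * (m * M ^ 2) := by
          rw [hMsq]; field_simp; linarith
      _ ≤ _ := by gcongr
  calc volume S = 1 * volume S := (one_mul _).symm
    _ ≤ (ENNReal.ofReal (2 * √2 * ε) * ENNReal.ofReal (m * M ^ (d - 1))) * volume S := by gcongr
    _ = ENNReal.ofReal (2 * √2 * ε) * (ENNReal.ofReal (m * M ^ (d - 1)) * volume S) := by ring
    _ ≤ _ := by gcongr

lemma uniformSphere_cap_le {d : ℕ} [NeZero d] (hd : 3 ≤ d)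
    (v : OrthonormalBasis (Fin d) ℝ (Vec d)) (i₀ : Fin d) {ε : ℝ} (hε : 0 < ε) :
    uniformSphere d {x | 1 - inner ℝ (v i₀) (x : Vec d) ^ 2 < ε} ≤
      ENNReal.ofReal (2 * √2 * ε) := by
  by_cases hε' : 2 * ε ≤ 1
  · refine uniformSphere_le_of_cone (measurableSet_lt (by fun_prop) measurable_const) ?_
      (volume_cone_le hd v i₀ hε hε')
    intro x hx r hr0 hr1
    have hx1 : ‖(x : Vec d)‖ = 1 := by simp
    rw [Set.mem_ofPred_eq] at hx
    have hn : ‖r • (x : Vec d)‖ = r := by rw [norm_smul, hx1, Real.norm_of_nonneg hr0.le, mul_one]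
    refine ⟨by rw [hn]; exact hr1, ?_⟩
    rw [hn, inner_smul_right]
    nlinarith [pow_pos hr0 2]
  · refine prob_le_one.trans ?_
    rw [ENNReal.one_le_ofReal]
    have : 1 ≤ √2 := Real.one_le_sqrt.2 (by norm_num)
    nlinarith

end SphereMeasure

/-! ### Eigenbasis computations and one step of inexact deflation. -/

section Spectral
variable {d : ℕ} {A : Matrix (Fin d) (Fin d) ℝ} {lam : Fin d → ℝ}
  {v : OrthonormalBasis (Fin d) ℝ (Vec d)}

lemma inner_apply_of_eigenbasis (hA : ∀ i, A.toEuclideanLin (v i) = lam i • v i) (i : Fin d)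
    (x : Vec d) : inner ℝ (v i) (A.toEuclideanLin x) = lam i * inner ℝ (v i) x := by
  conv_lhs => rw [← v.sum_repr' x]
  simp only [map_sum, map_smul, hA, inner_sum, inner_smul_right, v.inner_eq_ite]
  simp [mul_comm]

lemma inner_eq_sum (v : OrthonormalBasis (Fin d) ℝ (Vec d)) (x y : Vec d) :
    inner ℝ x y = ∑ i, inner ℝ (v i) x * inner ℝ (v i) y := by
  rw [← v.sum_inner_mul_inner x y]
  exact Finset.sum_congr rfl fun i _ => by rw [real_inner_comm]

lemma norm_sq_eq_sum (v : OrthonormalBasis (Fin d) ℝ (Vec d)) (x : Vec d) :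
    ‖x‖ ^ 2 = ∑ i, inner ℝ (v i) x ^ 2 := by
  rw [← real_inner_self_eq_norm_sq, inner_eq_sum v]
  exact Finset.sum_congr rfl fun i _ => (sq _).symm

lemma norm_sq_eq_add_sum (v : OrthonormalBasis (Fin d) ℝ (Vec d)) (i₀ : Fin d) (x : Vec d) :
    ‖x‖ ^ 2 = inner ℝ (v i₀) x ^ 2 + ∑ i ∈ Finset.univ.erase i₀, inner ℝ (v i) x ^ 2 := by
  rw [norm_sq_eq_sum v,
    Finset.add_sum_erase _ (fun i => inner ℝ (v i) x ^ 2) (Finset.mem_univ i₀)]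

lemma rayleigh_eq_sum (hA : ∀ i, A.toEuclideanLin (v i) = lam i • v i) (x : Vec d) :
    rayleigh A x = ∑ i, lam i * inner ℝ (v i) x ^ 2 := by
  rw [rayleigh, inner_eq_sum v]
  refine Finset.sum_congr rfl fun i _ => ?_
  rw [inner_apply_of_eigenbasis hA]; ring

lemma inner_apply_comm (hA : ∀ i, A.toEuclideanLin (v i) = lam i • v i) (x y : Vec d) :
    inner ℝ (A.toEuclideanLin x) y = inner ℝ x (A.toEuclideanLin y) := by
  rw [inner_eq_sum v, inner_eq_sum v x]
  refine Finset.sum_congr rfl fun i _ => ?_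
  rw [inner_apply_of_eigenbasis hA, inner_apply_of_eigenbasis hA]; ring

lemma deflate_apply (A : Matrix (Fin d) (Fin d) ℝ) (q x : Vec d) :
    (deflate A q).toEuclideanLin x =
      A.toEuclideanLin x - (rayleigh A q * inner ℝ q x) • q := by
  ext k
  simp only [deflate, map_sub, map_smul, LinearMap.sub_apply, LinearMap.smul_apply,
    PiLp.sub_apply, PiLp.smul_apply, smul_eq_mul, mul_assoc]
  congr 2
  simp [Matrix.toLpLin_apply, Matrix.mulVec, dotProduct, Matrix.vecMulVec, PiLp.inner_apply,
    Finset.mul_sum, mul_comm, mul_assoc]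

lemma rayleigh_nonneg (hA : ∀ i, A.toEuclideanLin (v i) = lam i • v i) (h0 : ∀ i, 0 ≤ lam i)
    (x : Vec d) : 0 ≤ rayleigh A x := by
  rw [rayleigh_eq_sum hA]
  exact Finset.sum_nonneg fun i _ => mul_nonneg (h0 i) (sq_nonneg _)

lemma rayleigh_le (hA : ∀ i, A.toEuclideanLin (v i) = lam i • v i) {L : ℝ} (hL : ∀ i, lam i ≤ L)
    (x : Vec d) : rayleigh A x ≤ L * ‖x‖ ^ 2 := by
  rw [rayleigh_eq_sum hA, norm_sq_eq_sum v, Finset.mul_sum]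
  exact Finset.sum_le_sum fun i _ => mul_le_mul_of_nonneg_right (hL i) (sq_nonneg _)

lemma eigenvalue_nonneg (hpsd : A.PosSemidef) (hA : ∀ i, A.toEuclideanLin (v i) = lam i • v i)
    (i : Fin d) : 0 ≤ lam i := by
  have h := hpsd.dotProduct_mulVec_nonneg (v i).ofLp
  have h2 : inner ℝ (v i) (A.toEuclideanLin (v i)) = lam i := by
    rw [inner_apply_of_eigenbasis hA, v.inner_eq_one, mul_one]
  rw [← h2]
  simpa [PiLp.inner_apply, Matrix.toLpLin_apply, dotProduct, mul_comm] using h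

/-- For a unit vector `q` the residual `A q - (qᵀ A q) q` is no longer than `(A - L) q`. -/
lemma norm_residual_le {q : Vec d} (hq : ‖q‖ = 1) (L : ℝ) :
    ‖A.toEuclideanLin q - rayleigh A q • q‖ ≤ ‖A.toEuclideanLin q - L • q‖ := by
  have h : ‖A.toEuclideanLin q - L • q‖ ^ 2 =
      ‖A.toEuclideanLin q - rayleigh A q • q‖ ^ 2 + (rayleigh A q - L) ^ 2 := by
    have e : ∀ c : ℝ, ‖A.toEuclideanLin q - c • q‖ ^ 2 =
        ‖A.toEuclideanLin q‖ ^ 2 - 2 * c * rayleigh A q + c ^ 2 := by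
      intro c
      rw [norm_sub_sq_real, inner_smul_right, norm_smul, hq, real_inner_comm, Real.norm_eq_abs,
        mul_one, sq_abs, rayleigh]
      ring
    rw [e, e]; ring
  exact le_of_sq_le_sq (by nlinarith [sq_nonneg (rayleigh A q - L)]) (norm_nonneg _)

lemma norm_apply_sub_smul_le (hA : ∀ i, A.toEuclideanLin (v i) = lam i • v i)
    (h0 : ∀ i, 0 ≤ lam i) {i₀ : Fin d} (hle : ∀ i, lam i ≤ lam i₀) {q : Vec d} {s : ℝ}
    (hs : 0 ≤ s) (hqs : ∑ i ∈ Finset.univ.erase i₀, inner ℝ (v i) q ^ 2 ≤ s ^ 2) :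
    ‖A.toEuclideanLin q - lam i₀ • q‖ ≤ lam i₀ * s := by
  refine le_of_sq_le_sq ?_ (mul_nonneg (h0 _) hs)
  rw [norm_sq_eq_add_sum v i₀]
  have e : ∀ i, inner ℝ (v i) (A.toEuclideanLin q - lam i₀ • q) =
      (lam i - lam i₀) * inner ℝ (v i) q := by
    intro i
    rw [inner_sub_right, inner_apply_of_eigenbasis hA, inner_smul_right]; ring
  rw [e, sub_self, zero_mul, zero_pow two_ne_zero, zero_add]
  calc _ ≤ ∑ i ∈ Finset.univ.erase i₀, lam i₀ ^ 2 * inner ℝ (v i) q ^ 2 := by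
        refine Finset.sum_le_sum fun i _ => ?_
        rw [e, mul_pow]
        refine mul_le_mul_of_nonneg_right ?_ (sq_nonneg _)
        nlinarith [h0 i, hle i]
    _ ≤ _ := by
        rw [← Finset.mul_sum, mul_pow]
        exact mul_le_mul_of_nonneg_left hqs (sq_nonneg _)

lemma abs_inner_le_of_inner_eq_zero {i₀ : Fin d} {q g : Vec d} {s : ℝ} (hs : 0 ≤ s)
    (hqs : ∑ i ∈ Finset.univ.erase i₀, inner ℝ (v i) q ^ 2 ≤ s ^ 2)
    (hg : inner ℝ (v i₀) g = 0) : |inner ℝ q g| ≤ s * ‖g‖ := by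
  refine abs_le_of_sq_le_sq ?_ (by positivity)
  rw [inner_eq_sum v, ← Finset.add_sum_erase _ _ (Finset.mem_univ i₀), hg, mul_zero, zero_add,
    mul_pow, norm_sq_eq_add_sum v i₀ g, hg, zero_pow two_ne_zero, zero_add]
  refine (Finset.sum_mul_sq_le_sq_mul_sq _ _ _).trans ?_
  exact mul_le_mul_of_nonneg_right hqs (Finset.sum_nonneg fun i _ => sq_nonneg _)

/-- One step of inexact deflation keeps the form `g + ζ q` and makes `ζ` small as soon as the
new `q` is close to the leading eigenvector. -/
lemma deflate_step (hA : ∀ i, A.toEuclideanLin (v i) = lam i • v i)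
    (h0 : ∀ i, 0 ≤ lam i) {i₀ : Fin d} (hle : ∀ i, lam i ≤ lam i₀) {q q' g : Vec d} {n ζ s : ℝ}
    (hq : ‖q‖ = 1) (hq' : ‖q'‖ = 1) (hn : A.toEuclideanLin q = n • q') (hs : 0 ≤ s)
    (hqs : ∑ i ∈ Finset.univ.erase i₀, inner ℝ (v i) q' ^ 2 ≤ s ^ 2)
    (hg : inner ℝ (v i₀) g = 0) :
    ∃ ζ' : ℝ, (deflate A q').toEuclideanLin (g + ζ • q) = A.toEuclideanLin g + ζ' • q' ∧
      |ζ'| ≤ lam i₀ * s * (|ζ| + ‖g‖) := by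
  refine ⟨ζ * (n - rayleigh A q' * inner ℝ q' q) - rayleigh A q' * inner ℝ q' g, ?_, ?_⟩
  · rw [deflate_apply, map_add, map_smul, hn, inner_add_right, inner_smul_right]
    module
  · have h1 : n - rayleigh A q' * inner ℝ q' q =
        inner ℝ (A.toEuclideanLin q' - rayleigh A q' • q') q := by
      rw [inner_sub_left, inner_apply_comm hA, hn, inner_smul_right, inner_smul_left,
        real_inner_self_eq_norm_sq, hq']
      simp
    have h2 : |n - rayleigh A q' * inner ℝ q' q| ≤ lam i₀ * s := by
      rw [h1]
      refine (abs_real_inner_le_norm _ _).trans ?_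
      rw [hq, mul_one]
      exact (norm_residual_le hq' _).trans (norm_apply_sub_smul_le hA h0 hle hs hqs)
    have h3 : |inner ℝ q' g| ≤ s * ‖g‖ := abs_inner_le_of_inner_eq_zero hs hqs hg
    have h4 : |rayleigh A q'| ≤ lam i₀ := by
      rw [abs_of_nonneg (rayleigh_nonneg hA h0 _)]
      simpa [hq'] using rayleigh_le hA hle q'
    calc _ ≤ |ζ| * |n - rayleigh A q' * inner ℝ q' q| + |rayleigh A q'| * |inner ℝ q' g| := by
          rw [← abs_mul, ← abs_mul]; exact abs_sub _ _
      _ ≤ |ζ| * (lam i₀ * s) + lam i₀ * (s * ‖g‖) := by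
          have := h0 i₀
          gcongr
      _ = _ := by ring

end Spectral

/-! ### Pre-momentum phase: unnormalized iterates and the scalar recursion for the error. -/

/-- The second component of the pre-momentum phase without normalization. -/
noncomputable def rawSecond {d : ℕ} (A : Matrix (Fin d) (Fin d) ℝ) (q₀ w₀ : Vec d) : ℕ → Vec d
  | 0 => w₀
  | j + 1 => (deflate A (preMomentum A q₀ w₀ (j + 1)).1).toEuclideanLin (rawSecond A q₀ w₀ j)

/-- Normalization can be postponed to the last step; the zero vector causes no exception because its
normalization is 0. -/
lemma normalize_map_normalize {d : ℕ} (f : Vec d →ₗ[ℝ] Vec d) (x : Vec d) :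
    NormedSpace.normalize (f (NormedSpace.normalize x)) = NormedSpace.normalize (f x) := by
  by_cases hx : x = 0
  · simp [hx]
  · rw [show NormedSpace.normalize x = ‖x‖⁻¹ • x from rfl, map_smul]
    exact NormedSpace.normalize_smul_of_pos (inv_pos.2 (norm_pos_iff.2 hx)) _

lemma preMomentum_snd_eq {d : ℕ} (A : Matrix (Fin d) (Fin d) ℝ) {q₀ w₀ : Vec d}
    (hw : ‖w₀‖ = 1) (j : ℕ) :
    (preMomentum A q₀ w₀ j).2 = NormedSpace.normalize (rawSecond A q₀ w₀ j) := by
  induction j with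
  | zero => simp [preMomentum, rawSecond, NormedSpace.normalize, hw]
  | succ j ih =>
    rw [rawSecond, ← normalize_map_normalize, ← ih]
    rfl

section PreMomentum
variable {d : ℕ} {A : Matrix (Fin d) (Fin d) ℝ} {lam : Fin d → ℝ}
  {v : OrthonormalBasis (Fin d) ℝ (Vec d)}

/-- The first component of the pre-momentum phase is the power method. -/
lemma preMomentum_fst (hA : ∀ i, A.toEuclideanLin (v i) = lam i • v i) {i₀ : Fin d}
    (hpos : 0 < lam i₀) {q₀ : Vec d} (w₀ : Vec d) (hq : ‖q₀‖ = 1)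
    (ha : inner ℝ (v i₀) q₀ ≠ 0) (j : ℕ) :
    ‖(preMomentum A q₀ w₀ j).1‖ = 1 ∧ ∃ r : ℝ, 0 < r ∧
      ∀ i, inner ℝ (v i) (preMomentum A q₀ w₀ j).1 = r * (lam i ^ j * inner ℝ (v i) q₀) := by
  induction j with
  | zero => exact ⟨hq, 1, one_pos, fun i => by simp [preMomentum]⟩
  | succ j ih =>
    obtain ⟨-, r, hr, h⟩ := ih
    set q := (preMomentum A q₀ w₀ j).1
    have hne : A.toEuclideanLin q ≠ 0 := by
      intro h0
      have := inner_apply_of_eigenbasis hA i₀ q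
      rw [h0, inner_zero_right, h] at this
      exact (mul_ne_zero hpos.ne' (mul_ne_zero hr.ne' (mul_ne_zero (pow_pos hpos j).ne' ha)))
        this.symm
    have e : (preMomentum A q₀ w₀ (j + 1)).1 = NormedSpace.normalize (A.toEuclideanLin q) := rfl
    refine ⟨by rw [e]; exact NormedSpace.norm_normalize_eq_one_iff.2 hne,
      ‖A.toEuclideanLin q‖⁻¹ * r, by positivity, fun i => ?_⟩
    rw [e, NormedSpace.normalize, inner_smul_right, inner_apply_of_eigenbasis hA, h]
    ring

lemma apply_preMomentum_fst (A : Matrix (Fin d) (Fin d) ℝ) (q₀ w₀ : Vec d) (j : ℕ) :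
    A.toEuclideanLin (preMomentum A q₀ w₀ j).1 =
      ‖A.toEuclideanLin (preMomentum A q₀ w₀ j).1‖ • (preMomentum A q₀ w₀ (j + 1)).1 := by
  exact (NormedSpace.norm_smul_normalize _).symm

/-- Geometric decay of the angle in the power method. -/
lemma sum_erase_preMomentum_fst_le (hA : ∀ i, A.toEuclideanLin (v i) = lam i • v i)
    (h0 : ∀ i, 0 ≤ lam i) {i₀ : Fin d} (hpos : 0 < lam i₀) {l : ℝ}
    (hl : ∀ i, i ≠ i₀ → lam i ≤ l) {q₀ : Vec d} (w₀ : Vec d) (hq : ‖q₀‖ = 1)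
    (ha : inner ℝ (v i₀) q₀ ≠ 0) (j : ℕ) :
    ∑ i ∈ Finset.univ.erase i₀, inner ℝ (v i) (preMomentum A q₀ w₀ j).1 ^ 2 ≤
      ((1 - inner ℝ (v i₀) q₀ ^ 2) / inner ℝ (v i₀) q₀ ^ 2 * ((l / lam i₀) ^ j) ^ 2) *
        inner ℝ (v i₀) (preMomentum A q₀ w₀ j).1 ^ 2 := by
  obtain ⟨-, r, hr, h⟩ := preMomentum_fst hA hpos w₀ hq ha j
  have hsum : ∑ i ∈ Finset.univ.erase i₀, inner ℝ (v i) q₀ ^ 2 = 1 - inner ℝ (v i₀) q₀ ^ 2 := by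
    have := norm_sq_eq_add_sum v i₀ q₀
    rw [hq] at this; linarith
  calc _ ≤ ∑ i ∈ Finset.univ.erase i₀, r ^ 2 * (l ^ j) ^ 2 * inner ℝ (v i) q₀ ^ 2 := by
        refine Finset.sum_le_sum fun i hi => ?_
        rw [h, mul_pow, mul_pow, ← mul_assoc]
        have h1 := h0 i
        have h2 := hl i (Finset.ne_of_mem_erase hi)
        gcongr
    _ = _ := by
        rw [← Finset.mul_sum, hsum, h, div_pow]
        field_simp

/-- Decomposition of the unnormalized second component. -/
lemma rawSecond_decomposition (hA : ∀ i, A.toEuclideanLin (v i) = lam i • v i)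
    (h0 : ∀ i, 0 ≤ lam i) {i₀ : Fin d} (hle : ∀ i, lam i ≤ lam i₀) (hpos : 0 < lam i₀)
    {q₀ w₀ g : Vec d} {ζ : ℝ} (hq : ‖q₀‖ = 1)
    (ha : inner ℝ (v i₀) q₀ ≠ 0) (hg : inner ℝ (v i₀) g = 0) (hw : w₀ = g + ζ • q₀)
    {s : ℕ → ℝ} (hs : ∀ j, 0 ≤ s j)
    (hqs : ∀ j, ∑ i ∈ Finset.univ.erase i₀, inner ℝ (v i) (preMomentum A q₀ w₀ j).1 ^ 2
      ≤ s j ^ 2) :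
    ∃ z : ℕ → ℝ, z 0 = ζ ∧
      (∀ j, rawSecond A q₀ w₀ j =
        (A.toEuclideanLin ^ j) g + z j • (preMomentum A q₀ w₀ j).1) ∧
      ∀ j, |z (j + 1)| ≤ lam i₀ * s (j + 1) * (|z j| + ‖(A.toEuclideanLin ^ j) g‖) := by
  have hgj : ∀ j, inner ℝ (v i₀) ((A.toEuclideanLin ^ j) g) = 0 := by
    intro j
    induction j with
    | zero => simpa using hg
    | succ j ih => rw [pow_succ', Module.End.mul_apply, inner_apply_of_eigenbasis hA, ih, mul_zero]
  have step : ∀ j ζ, ∃ ζ' : ℝ, (deflate A (preMomentum A q₀ w₀ (j + 1)).1).toEuclideanLin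
      ((A.toEuclideanLin ^ j) g + ζ • (preMomentum A q₀ w₀ j).1) =
        (A.toEuclideanLin ^ (j + 1)) g + ζ' • (preMomentum A q₀ w₀ (j + 1)).1 ∧
      |ζ'| ≤ lam i₀ * s (j + 1) * (|ζ| + ‖(A.toEuclideanLin ^ j) g‖) := by
    intro j ζ
    have := deflate_step (ζ := ζ) hA h0 hle (preMomentum_fst hA hpos w₀ hq ha j).1
      (preMomentum_fst hA hpos w₀ hq ha (j + 1)).1 (apply_preMomentum_fst A q₀ w₀ j) (hs (j + 1))
      (hqs (j + 1)) (hgj j)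
    rwa [pow_succ', Module.End.mul_apply]
  choose F hF hF' using step
  let z : ℕ → ℝ := fun j => Nat.rec ζ F j
  refine ⟨z, rfl, fun j => ?_, fun j => hF' j (z j)⟩
  induction j with
  | zero => simpa [rawSecond, preMomentum, z] using hw
  | succ j ih => rw [rawSecond, ih]; exact hF j (z j)

end PreMomentum

/-- A scalar recursion that first grows and is later damped. -/
lemma damped_recursion {R : ℝ} (hR : 1 ≤ R) {X s : ℕ → ℝ} (hX : ∀ j, 0 ≤ X j)
    (hX0 : X 0 ≤ 1) (hs : ∀ j, 0 ≤ s j) (hs1 : ∀ j, s j ≤ 1)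
    (hstep : ∀ j, X (j + 1) ≤ R * s (j + 1) * (X j + 1)) {m : ℕ}
    (hlate : ∀ j, m < j → R * s j ≤ 1 / (4 * R)) {J : ℕ} (hJ : 2 * m + 1 ≤ J) :
    X J ≤ 4 * R * s J := by
  -- Growth by at most 2R per step up to time m is undone by m later steps with factor 1/(4R),
  -- leaving 2^{-m}. So X ≤ 3 from time 2m on, and one further step gives R s (3 + 1).
  have early : ∀ j, X j + 1 ≤ 2 * (2 * R) ^ j := by
    intro j
    induction j with
    | zero => simpa using by linarith
    | succ j ih =>
      have h1 : R * s (j + 1) * (X j + 1) ≤ R * (X j + 1) := by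
        have := hX j
        have := hs1 (j + 1)
        have : R * s (j + 1) ≤ R := by nlinarith
        gcongr
      have h2 : 1 ≤ R * (X j + 1) := by nlinarith [hX j]
      calc X (j + 1) + 1 ≤ 2 * R * (X j + 1) := by linarith [hstep j]
        _ ≤ 2 * R * (2 * (2 * R) ^ j) := by gcongr
        _ = _ := by ring
  have late : ∀ k, X (m + k) ≤ (1 / (4 * R)) ^ k * (2 * (2 * R) ^ m) + 1 := by
    intro k
    induction k with
    | zero => simpa using by linarith [early m]
    | succ k ih =>
      have h1 := hstep (m + k)
      have h2 := hlate (m + k + 1) (by omega)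
      have h3 : 1 / (4 * R) ≤ 1 / 4 := by gcongr; linarith
      have h4 : 0 ≤ 1 / (4 * R) := by positivity
      calc X (m + (k + 1)) ≤ R * s (m + k + 1) * (X (m + k) + 1) := h1
        _ ≤ 1 / (4 * R) * (X (m + k) + 1) := by
          have := hX (m + k)
          gcongr
        _ ≤ 1 / (4 * R) * ((1 / (4 * R)) ^ k * (2 * (2 * R) ^ m) + 1 + 1) := by gcongr
        _ ≤ _ := by rw [pow_succ]; nlinarith
  have bound : ∀ j, 2 * m ≤ j → X j ≤ 3 := by
    intro j hj
    obtain ⟨k, rfl⟩ : ∃ k, j = m + k := ⟨j - m, by omega⟩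
    have h1 : (1 / (4 * R)) ^ k ≤ (1 / (4 * R)) ^ m :=
      pow_le_pow_of_le_one (by positivity) (by rw [div_le_one (by positivity)]; linarith)
        (by omega)
    have h2 : (1 / (4 * R)) ^ m * (2 * R) ^ m = (1 / 2) ^ m := by
      rw [← mul_pow]; congr 1; field_simp; norm_num
    have h3 : ((1 : ℝ) / 2) ^ m ≤ 1 := pow_le_one₀ (by norm_num) (by norm_num)
    have h4 : (1 / (4 * R)) ^ k * (2 * R) ^ m ≤ (1 / (4 * R)) ^ m * (2 * R) ^ m := by gcongr
    linarith [late k]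
  obtain ⟨j, rfl⟩ : ∃ j, J = j + 1 := ⟨J - 1, by omega⟩
  have h1 := bound j (by omega)
  have h2 := hs (j + 1)
  have h3 : 0 ≤ R * s (j + 1) := by positivity
  nlinarith [hstep j]

/-! ### Momentum phase: a heavy-ball recursion with varying coefficient. -/

/-- A Lyapunov function for the heavy-ball recursion `(1 - s) z⁺ = κ z - s z₋` with `s` varying
in `[0, 7/25]`. -/
noncomputable def heavyBallEnergy (κ y z : ℝ) : ℝ :=
  if κ < 2 / 5 then max |z| (49 / 50 * |y|) else |z| + 7 / 10 * |z - y|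

lemma abs_le_heavyBallEnergy (κ y z : ℝ) : |z| ≤ heavyBallEnergy κ y z := by
  unfold heavyBallEnergy
  split_ifs
  · exact le_max_left _ _
  · linarith [abs_nonneg (z - y)]

lemma heavyBallEnergy_first_step {κ : ℝ} (h0 : 0 ≤ κ) (h1 : κ ≤ 1) (z : ℝ) :
    heavyBallEnergy κ z (κ * z) ≤ |z| := by
  have h := abs_nonneg z
  unfold heavyBallEnergy
  split_ifs
  · rw [abs_mul, abs_of_nonneg h0]
    exact max_le (by nlinarith) (by linarith)
  · have e : κ * z - z = -((1 - κ) * z) := by ring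
    rw [e, abs_neg, abs_mul, abs_mul, abs_of_nonneg h0, abs_of_nonneg (by linarith : 0 ≤ 1 - κ)]
    nlinarith

/-- Since s changes with time, eigenvalues of a fixed recursion matrix do not suffice. For κ < 2/5
the triangle inequality already gives |z| ≤ (20/21) V. For κ ≥ 2/5 > s, rewrite the recursion in y
and the increment y - x; the weight 7/10 makes both coefficients contract, as 17/10 · s ≤ (1 - s) ·
49/50 · 7/10 at s = 7/25. Using κ' gives one rate for all coordinates. -/
lemma heavyBallEnergy_step {κ κ' s x y z : ℝ} (h0 : 0 ≤ κ) (h1 : κ ≤ 1) (hκ : κ ≤ κ')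
    (hs0 : 0 ≤ s) (hs : s ≤ 7 / 25) (hz : (1 - s) * z = κ * y - s * x) :
    heavyBallEnergy κ y z ≤ max (49 / 50) (1 - 3 / 10 * (1 - κ')) * heavyBallEnergy κ x y := by
  set q := max (49 / 50 : ℝ) (1 - 3 / 10 * (1 - κ'))
  have hq1 : 49 / 50 ≤ q := le_max_left _ _
  have hq2 : 1 - 3 / 10 * (1 - κ') ≤ q := le_max_right _ _
  have hV : 0 ≤ heavyBallEnergy κ x y := (abs_nonneg _).trans (abs_le_heavyBallEnergy κ x y)
  have h1s : 0 < 1 - s := by linarith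
  unfold heavyBallEnergy at hV ⊢
  split_ifs at hV ⊢ with hc
  · set V := max |y| (49 / 50 * |x|)
    have hy : |y| ≤ V := le_max_left _ _
    have hx : 49 / 50 * |x| ≤ V := le_max_right _ _
    have h2 : (1 - s) * |z| ≤ κ * |y| + s * |x| := by
      rw [← abs_of_pos h1s, ← abs_mul, hz]
      refine (abs_sub _ _).trans ?_
      rw [abs_mul, abs_mul, abs_of_nonneg h0, abs_of_nonneg hs0]
    refine max_le ?_ ?_
    · have h3 : κ * |y| ≤ 2 / 5 * V := by
        have := abs_nonneg y
        nlinarith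
      have h4 : s * |x| ≤ 7 / 25 * (50 / 49 * V) := by
        have := abs_nonneg x
        nlinarith
      have h5 : (1 - s) * |z| ≥ 18 / 25 * |z| := by nlinarith [abs_nonneg z]
      nlinarith
    · nlinarith
  · push Not at hc
    have hp : (1 - s) * (z - y) = s * (y - x) - (1 - κ) * y := by linarith
    have hκs : 1 - s - (1 - κ) ≥ 0 := by linarith
    have e1 : (1 - s) * z = (1 - s - (1 - κ)) * y + s * (y - x) := by linarith
    have h2 : (1 - s) * |z| ≤ (κ - s) * |y| + s * |y - x| := by
      rw [← abs_of_pos h1s, ← abs_mul, e1]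
      refine (abs_add_le _ _).trans ?_
      rw [abs_mul, abs_mul, abs_of_nonneg hκs, abs_of_nonneg hs0]
      linarith
    have h3 : (1 - s) * |z - y| ≤ s * |y - x| + (1 - κ) * |y| := by
      rw [← abs_of_pos h1s, ← abs_mul, hp]
      refine (abs_sub _ _).trans ?_
      rw [abs_mul, abs_mul, abs_of_nonneg hs0, abs_of_nonneg (by linarith : 0 ≤ 1 - κ)]
    have hy := abs_nonneg y
    have hyx := abs_nonneg (y - x)
    have h4 : (1 - s) * (|z| + 7 / 10 * |z - y|) ≤
        (κ - s + 7 / 10 * (1 - κ)) * |y| + 17 / 10 * s * |y - x| := by linarith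
    have h5 : κ - s + 7 / 10 * (1 - κ) ≤ (1 - s) * q := by nlinarith
    have h6 : 17 / 10 * s ≤ (1 - s) * (q * (7 / 10)) := by nlinarith
    have h7 : (1 - s) * (|z| + 7 / 10 * |z - y|) ≤
        (1 - s) * (q * (|y| + 7 / 10 * |y - x|)) := by
      calc _ ≤ _ := h4
        _ ≤ (1 - s) * q * |y| + (1 - s) * (q * (7 / 10)) * |y - x| := by gcongr
        _ = _ := by ring
    exact le_of_mul_le_mul_left h7 h1s

section Momentum
variable {d : ℕ} {A : Matrix (Fin d) (Fin d) ℝ} {lam : Fin d → ℝ}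
  {v : OrthonormalBasis (Fin d) ℝ (Vec d)}

lemma momentum_step (hA : ∀ i, A.toEuclideanLin (v i) = lam i • v i) {i₀ : Fin d}
    (hpos : 0 < lam i₀) (hone : lam i₀ ≤ 1) {β : ℝ} (hβ0 : 0 ≤ β) (hβ : β ≤ lam i₀ ^ 2 / 4)
    {x y : Vec d} (hx : ‖x‖ = 1) (hab : 0 < inner ℝ (v i₀) x * inner ℝ (v i₀) y)
    (hb : 4 / 5 ≤ inner ℝ (v i₀) y ^ 2) :
    ∃ s : ℝ, 0 ≤ s ∧ s ≤ 7 / 25 ∧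
      0 < inner ℝ (v i₀) y * inner ℝ (v i₀) (A.toEuclideanLin y - β • x) ∧
      ∀ i, (1 - s) * (inner ℝ (v i) (A.toEuclideanLin y - β • x) /
          inner ℝ (v i₀) (A.toEuclideanLin y - β • x)) =
        lam i / lam i₀ * (inner ℝ (v i) y / inner ℝ (v i₀) y) -
          s * (inner ℝ (v i) x / inner ℝ (v i₀) x) := by
  have hu : ∀ i, inner ℝ (v i) (A.toEuclideanLin y - β • x) =
      lam i * inner ℝ (v i) y - β * inner ℝ (v i) x := by
    intro i
    rw [inner_sub_right, inner_apply_of_eigenbasis hA, inner_smul_right]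
  have ha1 : inner ℝ (v i₀) x ^ 2 ≤ 1 := by
    have := norm_sq_eq_add_sum v i₀ x
    have : 0 ≤ ∑ i ∈ Finset.univ.erase i₀, inner ℝ (v i) x ^ 2 :=
      Finset.sum_nonneg fun i _ => sq_nonneg _
    nlinarith
  simp only [hu]
  generalize (inner ℝ (v i₀) x : ℝ) = a at *
  generalize (inner ℝ (v i₀) y : ℝ) = b at *
  have ha0 : a ≠ 0 := left_ne_zero_of_mul hab.ne'
  have hb0 : b ≠ 0 := right_ne_zero_of_mul hab.ne'
  have hr0 : 0 < a / b := by
    have : a / b = a * b / b ^ 2 := by field_simp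
    rw [this]; positivity
  -- From a² ≤ 1 and b² ≥ 4/5, (a/b)² ≤ 5/4 ≤ (28/25)²; with β/λ₁ ≤ 1/4 this is the source of 7/25.
  have hr1 : a / b ≤ 28 / 25 := by
    refine le_of_sq_le_sq ?_ (by norm_num)
    rw [div_pow, div_le_iff₀ (by positivity)]
    linarith
  have hs0 : 0 ≤ β / lam i₀ * (a / b) := by positivity
  have hs1 : β / lam i₀ * (a / b) ≤ 7 / 25 := by
    have h1 : β / lam i₀ ≤ 1 / 4 := by
      rw [div_le_iff₀ hpos]; nlinarith
    calc _ ≤ 1 / 4 * (28 / 25 : ℝ) := by gcongr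
      _ = _ := by norm_num
  have hfac : lam i₀ * b - β * a = lam i₀ * b * (1 - β / lam i₀ * (a / b)) := by
    field_simp
  have h1s : 0 < 1 - β / lam i₀ * (a / b) := by linarith
  refine ⟨β / lam i₀ * (a / b), hs0, hs1, ?_, fun i => ?_⟩
  · rw [hfac]
    have : b * (lam i₀ * b * (1 - β / lam i₀ * (a / b))) =
      lam i₀ * b ^ 2 * (1 - β / lam i₀ * (a / b)) := by ring
    rw [this]; positivity
  · rw [hfac]
    generalize hs : β / lam i₀ * (a / b) = s at *
    have hβe : β = s * lam i₀ * b / a := by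
      rw [← hs]; field_simp
    rw [hβe]
    field_simp

lemma four_fifths_le_inner_sq {i₀ : Fin d} {y : Vec d} (hy : ‖y‖ = 1)
    (h : ∑ i ∈ Finset.univ.erase i₀, inner ℝ (v i) y ^ 2 ≤ 1 / 4 * inner ℝ (v i₀) y ^ 2) :
    4 / 5 ≤ inner ℝ (v i₀) y ^ 2 := by
  have := norm_sq_eq_add_sum v i₀ y
  rw [hy] at this
  linarith

/-- Local convergence of the momentum phase. -/
lemma momentumPair_tendsto (hA : ∀ i, A.toEuclideanLin (v i) = lam i • v i)
    (h0 : ∀ i, 0 ≤ lam i) {i₀ : Fin d} (hpos : 0 < lam i₀) (hone : lam i₀ ≤ 1)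
    {κ : ℝ} (hκ1 : κ < 1) (hκ : ∀ i, i ≠ i₀ → lam i ≤ κ * lam i₀)
    {β : ℝ} (hβ0 : 0 ≤ β) (hβ : β ≤ lam i₀ ^ 2 / 4) {p : Vec d} (hp : ‖p‖ = 1)
    (hp0 : ∑ i ∈ Finset.univ.erase i₀, inner ℝ (v i) p ^ 2 ≤ 1 / 4 * inner ℝ (v i₀) p ^ 2) :
    Tendsto (fun k => sinSq (momentumPair A β p k).2 (v i₀)) atTop (𝓝 0) := by
  set q := max (49 / 50 : ℝ) (1 - 3 / 10 * (1 - κ))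
  have hq0 : 0 ≤ q := le_max_of_le_left (by norm_num)
  have hq1 : q < 1 := max_lt (by norm_num) (by linarith)
  let z : Fin d → Vec d → ℝ := fun i x => inner ℝ (v i) x / inner ℝ (v i₀) x
  have hpp : 0 < inner ℝ (v i₀) p ^ 2 := by linarith [four_fifths_le_inner_sq hp hp0]
  have small : ∀ (k : ℕ) (y : Vec d), inner ℝ (v i₀) y ≠ 0 →
      (∀ i, i ≠ i₀ → |z i y| ≤ q ^ k * |z i p|) →
      ∑ i ∈ Finset.univ.erase i₀, inner ℝ (v i) y ^ 2 ≤
        1 / 4 * (q ^ k) ^ 2 * inner ℝ (v i₀) y ^ 2 := by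
    intro k y hy h
    calc _ ≤ ∑ i ∈ Finset.univ.erase i₀, inner ℝ (v i₀) y ^ 2 *
          ((q ^ k) ^ 2 * (inner ℝ (v i) p ^ 2 / inner ℝ (v i₀) p ^ 2)) := by
          refine Finset.sum_le_sum fun i hi => ?_
          have h1 := h i (Finset.ne_of_mem_erase hi)
          have h2 : z i y ^ 2 ≤ (q ^ k * z i p) ^ 2 := by
            rw [← sq_abs, ← sq_abs (q ^ k * z i p), abs_mul, abs_of_nonneg (pow_nonneg hq0 k)]
            gcongr
          rw [mul_pow, div_pow, div_pow, div_le_iff₀ (by positivity)] at h2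
          linarith
      _ = inner ℝ (v i₀) y ^ 2 * ((q ^ k) ^ 2 *
          ((∑ i ∈ Finset.univ.erase i₀, inner ℝ (v i) p ^ 2) / inner ℝ (v i₀) p ^ 2)) := by
          rw [← Finset.mul_sum, ← Finset.mul_sum, Finset.sum_div]
      _ ≤ inner ℝ (v i₀) y ^ 2 * ((q ^ k) ^ 2 * (1 / 4)) := by
          have := (div_le_iff₀ hpp).2 hp0
          gcongr
      _ = _ := by ring
  have small' : ∀ (k : ℕ) (y : Vec d), ‖y‖ = 1 → inner ℝ (v i₀) y ≠ 0 →
      (∀ i, i ≠ i₀ → |z i y| ≤ q ^ k * |z i p|) → 4 / 5 ≤ inner ℝ (v i₀) y ^ 2 := by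
    intro k y hy1 hy h
    refine four_fifths_le_inner_sq hy1 ((small k y hy h).trans ?_)
    have : (q ^ k) ^ 2 ≤ 1 := pow_le_one₀ (by positivity) (pow_le_one₀ hq0 hq1.le)
    gcongr
    linarith
  have hzn : ∀ i (u : Vec d), u ≠ 0 → z i (NormedSpace.normalize u) = z i u := by
    intro i u hu
    have : ‖u‖⁻¹ ≠ 0 := inv_ne_zero (norm_ne_zero_iff.2 hu)
    simp only [z, NormedSpace.normalize, inner_smul_right]
    rw [mul_div_mul_left _ _ this]
  have hκi : ∀ i, i ≠ i₀ → lam i / lam i₀ ≤ κ := fun i hi => by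
    rw [div_le_iff₀ hpos]; exact hκ i hi
  -- The invariant starts at index 1: the initial previous iterate is 0, whose coordinate ratios are
  -- meaningless, and the first step is a plain power step.
  have inv : ∀ k, ‖(momentumPair A β p (k + 1)).1‖ = 1 ∧ ‖(momentumPair A β p (k + 1)).2‖ = 1 ∧
      0 < inner ℝ (v i₀) (momentumPair A β p (k + 1)).1 *
        inner ℝ (v i₀) (momentumPair A β p (k + 1)).2 ∧
      ∀ i, i ≠ i₀ → heavyBallEnergy (lam i / lam i₀) (z i (momentumPair A β p (k + 1)).1)
        (z i (momentumPair A β p (k + 1)).2) ≤ q ^ k * |z i p| := by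
    intro k
    induction k with
    | zero =>
      have e1 : (momentumPair A β p (0 + 1)).1 = p := rfl
      have e2 : (momentumPair A β p (0 + 1)).2 =
          NormedSpace.normalize (A.toEuclideanLin p) := by simp [momentumPair]
      rw [e1, e2]
      have hc := inner_apply_of_eigenbasis hA i₀ p
      have hp1 : inner ℝ (v i₀) p ≠ 0 := fun h => by simp [h] at hpp
      have hne : A.toEuclideanLin p ≠ 0 := by
        intro h
        rw [h, inner_zero_right] at hc
        exact mul_ne_zero hpos.ne' hp1 hc.symm
      refine ⟨hp, NormedSpace.norm_normalize_eq_one_iff.2 hne, ?_, fun i hi => ?_⟩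
      · have := norm_pos_iff.2 hne
        rw [NormedSpace.normalize, inner_smul_right, hc]
        calc 0 < ‖A.toEuclideanLin p‖⁻¹ * lam i₀ * inner ℝ (v i₀) p ^ 2 := by positivity
          _ = _ := by ring
      · rw [hzn i _ hne]
        have e3 : z i (A.toEuclideanLin p) = lam i / lam i₀ * z i p := by
          simp only [z, inner_apply_of_eigenbasis hA]
          field_simp
        rw [e3, pow_zero, one_mul]
        exact heavyBallEnergy_first_step (div_nonneg (h0 i) hpos.le)
          ((hκi i hi).trans hκ1.le) _
    | succ k ih =>
      obtain ⟨hx, hy, hxy, hV⟩ := ih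
      set x := (momentumPair A β p (k + 1)).1
      set y := (momentumPair A β p (k + 1)).2
      have e1 : (momentumPair A β p (k + 1 + 1)).1 = y := rfl
      have e2 : (momentumPair A β p (k + 1 + 1)).2 =
          NormedSpace.normalize (A.toEuclideanLin y - β • x) := rfl
      rw [e1, e2]
      -- Bootstrap: the energy bound keeps y near ±v₁, which keeps s in [0, 7/25], which lets the
      -- energy contract again.
      have hb := small' k y hy (right_ne_zero_of_mul hxy.ne')
        (fun i hi => (abs_le_heavyBallEnergy _ _ _).trans (hV i hi))
      obtain ⟨s, hs0, hs1, hpos', hrec⟩ := momentum_step hA hpos hone hβ0 hβ hx hxy hb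
      have hne : A.toEuclideanLin y - β • x ≠ 0 := by
        intro h
        rw [h, inner_zero_right, mul_zero] at hpos'
        exact lt_irrefl _ hpos'
      refine ⟨hy, NormedSpace.norm_normalize_eq_one_iff.2 hne, ?_, fun i hi => ?_⟩
      · have := norm_pos_iff.2 hne
        rw [NormedSpace.normalize, inner_smul_right, mul_left_comm]
        positivity
      · rw [hzn i _ hne]
        refine (heavyBallEnergy_step (div_nonneg (h0 i) hpos.le) ((hκi i hi).trans hκ1.le)
          (hκi i hi) hs0 hs1 (hrec i)).trans ?_
        rw [pow_succ', mul_assoc]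
        exact mul_le_mul_of_nonneg_left (hV i hi) hq0
  rw [← tendsto_add_atTop_iff_nat 1]
  have hsin : ∀ k, 0 ≤ sinSq (momentumPair A β p (k + 1)).2 (v i₀) ∧
      sinSq (momentumPair A β p (k + 1)).2 (v i₀) ≤ (q ^ 2) ^ k := by
    intro k
    obtain ⟨-, hy, hxy, hV⟩ := inv k
    set y := (momentumPair A β p (k + 1)).2
    have h1 := norm_sq_eq_add_sum v i₀ y
    have h2 := small k y (right_ne_zero_of_mul hxy.ne')
      (fun i hi => (abs_le_heavyBallEnergy _ _ _).trans (hV i hi))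
    have h3 : 0 ≤ ∑ i ∈ Finset.univ.erase i₀, inner ℝ (v i) y ^ 2 :=
      Finset.sum_nonneg fun i _ => sq_nonneg _
    rw [hy] at h1
    have e : sinSq y (v i₀) = ∑ i ∈ Finset.univ.erase i₀, inner ℝ (v i) y ^ 2 := by
      rw [sinSq, real_inner_comm]; linarith
    rw [e, ← pow_mul, mul_comm, pow_mul]
    refine ⟨h3, ?_⟩
    have h4 : 0 ≤ (q ^ k) ^ 2 := by positivity
    nlinarith
  refine squeeze_zero (fun k => (hsin k).1) (fun k => (hsin k).2) ?_
  exact tendsto_pow_atTop_nhds_zero_of_lt_one (by positivity) (by nlinarith)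

end Momentum

/-! ### Accuracy of the second eigenvalue estimate. -/

section SecondEstimate
variable {d : ℕ} {A : Matrix (Fin d) (Fin d) ℝ} {lam : Fin d → ℝ}
  {v : OrthonormalBasis (Fin d) ℝ (Vec d)}

/-- The error is the average of λ₂ - λ_i with weights ⟨v_i, W⟩²/‖W‖², the term i = i₁ vanishes, and
each gap is at most 1. -/
lemma abs_sub_rayleigh_normalize_mul_le (hA : ∀ i, A.toEuclideanLin (v i) = lam i • v i)
    (h0 : ∀ i, 0 ≤ lam i) (h1 : ∀ i, lam i ≤ 1) {i₀ i₁ : Fin d} (hne : i₁ ≠ i₀)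
    {W : Vec d} (hW : W ≠ 0) :
    |lam i₁ - rayleigh A (NormedSpace.normalize W)| * inner ℝ (v i₁) W ^ 2 ≤
      inner ℝ (v i₀) W ^ 2 +
        ∑ i ∈ (Finset.univ.erase i₀).erase i₁, inner ℝ (v i) W ^ 2 := by
  have hn : 0 < ‖W‖ ^ 2 := by have := norm_pos_iff.2 hW; positivity
  have hle : inner ℝ (v i₁) W ^ 2 ≤ ‖W‖ ^ 2 := by
    rw [norm_sq_eq_add_sum v i₁]
    have : 0 ≤ ∑ i ∈ Finset.univ.erase i₁, inner ℝ (v i) W ^ 2 :=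
      Finset.sum_nonneg fun i _ => sq_nonneg _
    linarith
  have e1 : (lam i₁ - rayleigh A (NormedSpace.normalize W)) * ‖W‖ ^ 2 =
      ∑ i ∈ Finset.univ.erase i₁, (lam i₁ - lam i) * inner ℝ (v i) W ^ 2 := by
    have e2 : rayleigh A (NormedSpace.normalize W) * ‖W‖ ^ 2 = rayleigh A W := by
      simp only [rayleigh, NormedSpace.normalize, map_smul, inner_smul_left, inner_smul_right,
        conj_trivial]
      have := norm_pos_iff.2 hW
      field_simp
    rw [sub_mul, e2, rayleigh_eq_sum hA, norm_sq_eq_sum v, Finset.mul_sum,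
      ← Finset.sum_sub_distrib, ← Finset.add_sum_erase _ _ (Finset.mem_univ i₁), sub_self, zero_add]
    exact Finset.sum_congr rfl fun i _ => by ring
  calc _ ≤ |lam i₁ - rayleigh A (NormedSpace.normalize W)| * ‖W‖ ^ 2 := by gcongr
    _ = |∑ i ∈ Finset.univ.erase i₁, (lam i₁ - lam i) * inner ℝ (v i) W ^ 2| := by
        rw [← e1, abs_mul, abs_of_pos hn]
    _ ≤ ∑ i ∈ Finset.univ.erase i₁, inner ℝ (v i) W ^ 2 := by
        refine (Finset.abs_sum_le_sum_abs _ _).trans (Finset.sum_le_sum fun i _ => ?_)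
        rw [abs_mul, abs_of_nonneg (sq_nonneg (inner ℝ (v i) W))]
        have : |lam i₁ - lam i| ≤ 1 :=
          abs_le.2 ⟨by linarith [h0 i₁, h1 i], by linarith [h0 i, h1 i₁]⟩
        nlinarith [sq_nonneg (inner ℝ (v i) W)]
    _ = _ := by
        rw [Finset.erase_right_comm,
          Finset.add_sum_erase _ (fun i => inner ℝ (v i) W ^ 2)
            (Finset.mem_erase.2 ⟨hne.symm, Finset.mem_univ i₀⟩)]

lemma inner_pow_apply (hA : ∀ i, A.toEuclideanLin (v i) = lam i • v i) (i : Fin d) (g : Vec d)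
    (j : ℕ) : inner ℝ (v i) ((A.toEuclideanLin ^ j) g) = lam i ^ j * inner ℝ (v i) g := by
  induction j with
  | zero => simp
  | succ j ih => rw [pow_succ', Module.End.mul_apply, inner_apply_of_eigenbasis hA, ih]; ring

lemma norm_pow_apply_le (hA : ∀ i, A.toEuclideanLin (v i) = lam i • v i)
    (h0 : ∀ i, 0 ≤ lam i) {i₀ : Fin d} {l : ℝ} (hl0 : 0 ≤ l) (hl : ∀ i, i ≠ i₀ → lam i ≤ l)
    {g : Vec d} (hg : inner ℝ (v i₀) g = 0) (j : ℕ) :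
    ‖(A.toEuclideanLin ^ j) g‖ ≤ l ^ j * ‖g‖ := by
  refine le_of_sq_le_sq ?_ (by positivity)
  rw [mul_pow, norm_sq_eq_add_sum v i₀, norm_sq_eq_add_sum v i₀ g, inner_pow_apply hA, hg,
    mul_zero, zero_pow two_ne_zero, zero_add, zero_add, Finset.mul_sum]
  refine Finset.sum_le_sum fun i hi => ?_
  rw [inner_pow_apply hA, mul_pow]
  have := h0 i
  have := hl i (Finset.ne_of_mem_erase hi)
  gcongr

lemma sum_erase_le_norm_sq (v : OrthonormalBasis (Fin d) ℝ (Vec d)) (i₀ : Fin d) (x : Vec d) :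
    ∑ i ∈ Finset.univ.erase i₀, inner ℝ (v i) x ^ 2 ≤ ‖x‖ ^ 2 := by
  rw [norm_sq_eq_add_sum v i₀]
  linarith [sq_nonneg (inner ℝ (v i₀) x)]

lemma sum_erase_erase_le_norm_sq (v : OrthonormalBasis (Fin d) ℝ (Vec d)) (i₀ i₁ : Fin d)
    (x : Vec d) :
    ∑ i ∈ (Finset.univ.erase i₀).erase i₁, inner ℝ (v i) x ^ 2 ≤ ‖x‖ ^ 2 :=
  (Finset.sum_le_sum_of_subset_of_nonneg (Finset.erase_subset _ _)
    fun _ _ _ => sq_nonneg _).trans (sum_erase_le_norm_sq v i₀ x)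

lemma inner_sq_le_norm_sq (v : OrthonormalBasis (Fin d) ℝ (Vec d)) (i₀ : Fin d) (x : Vec d) :
    inner ℝ (v i₀) x ^ 2 ≤ ‖x‖ ^ 2 := by
  have : 0 ≤ ∑ i ∈ Finset.univ.erase i₀, inner ℝ (v i) x ^ 2 :=
    Finset.sum_nonneg fun i _ => sq_nonneg _
  linarith [norm_sq_eq_add_sum v i₀ x]

/-- Rayleigh quotient of a vector of the form `Aᴶ g` plus a small perturbation. -/
lemma abs_sub_rayleigh_perturbed_mul_le (hA : ∀ i, A.toEuclideanLin (v i) = lam i • v i)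
    (h0 : ∀ i, 0 ≤ lam i) {i₀ i₁ : Fin d} (hne : i₁ ≠ i₀) (hle1 : ∀ i, lam i ≤ 1)
    (hpos : 0 < lam i₁) {α : ℝ} (hα : ∀ i, i ≠ i₀ → i ≠ i₁ → lam i ≤ lam i₁ - α)
    (hα0 : 0 < α) {W g q : Vec d} {a x p Y : ℝ} {J : ℕ} (hn : ‖q‖ = 1)
    (hg : inner ℝ (v i₀) g = 0) (hgn : |a| * ‖g‖ ≤ 2)
    (hWi : ∀ i, a * inner ℝ (v i) W = lam i ^ J * (a * inner ℝ (v i) g) + x * inner ℝ (v i) q)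
    (hYb : |x| ≤ Y * lam i₁ ^ J) (hp : p = |a * inner ℝ (v i₁) g|) (hYp : Y < p) :
    |lam i₁ - rayleigh A (NormedSpace.normalize W)| * (p - Y) ^ 2 ≤
      3 * Y ^ 2 + 8 * Real.exp (-(α * J)) ^ 2 := by
  have hLpos : 0 < lam i₁ ^ J := by positivity
  have hz2 : x ^ 2 ≤ Y ^ 2 * (lam i₁ ^ J) ^ 2 := by
    rw [← mul_pow, ← sq_abs]; gcongr
  have hq2 : ∀ i, inner ℝ (v i) q ^ 2 ≤ 1 := fun i => by
    simpa [hn] using inner_sq_le_norm_sq v i q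
  have hW0 : a ^ 2 * inner ℝ (v i₀) W ^ 2 ≤ Y ^ 2 * (lam i₁ ^ J) ^ 2 := by
    rw [← mul_pow, hWi, hg, mul_zero, mul_zero, zero_add, mul_pow]
    nlinarith [hq2 i₀, sq_nonneg x]
  have hW1 : (lam i₁ ^ J) ^ 2 * (p - Y) ^ 2 ≤ a ^ 2 * inner ℝ (v i₁) W ^ 2 := by
    rw [← mul_pow, ← mul_pow, ← sq_abs (a * inner ℝ (v i₁) W)]
    have h5 : |x * inner ℝ (v i₁) q| ≤ Y * lam i₁ ^ J := by
      rw [abs_mul]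
      have := (sq_le_one_iff_abs_le_one _).1 (hq2 i₁)
      have := abs_nonneg x
      nlinarith
    have h6 : lam i₁ ^ J * p = |lam i₁ ^ J * (a * inner ℝ (v i₁) g)| := by
      rw [abs_mul, abs_of_pos hLpos, hp]
    have h7 : lam i₁ ^ J * (p - Y) ≤ |a * inner ℝ (v i₁) W| := by
      rw [hWi]
      have := abs_sub_abs_le_abs_add (lam i₁ ^ J * (a * inner ℝ (v i₁) g))
        (x * inner ℝ (v i₁) q)
      linarith
    have : 0 < p - Y := by linarith
    gcongr
  -- Because λ₂ ≤ 1, the additive gap is also a relative one: λ₂ - α ≤ λ₂ (1 - α) ≤ λ₂ e^{-α}.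
  have hexp : ∀ i, i ≠ i₀ → i ≠ i₁ → lam i ^ J ≤ lam i₁ ^ J * Real.exp (-(α * J)) := by
    intro i hi hi'
    have e : Real.exp (-(α * J)) = Real.exp (-α) ^ J := by
      rw [← Real.exp_nat_mul]; congr 1; ring
    rw [e, ← mul_pow]
    have h8 := Real.add_one_le_exp (-α)
    have h9 : lam i ≤ lam i₁ * Real.exp (-α) := by
      nlinarith [hα i hi hi', hle1 i₁]
    have := h0 i
    gcongr
  have hW2 : a ^ 2 * ∑ i ∈ (Finset.univ.erase i₀).erase i₁, inner ℝ (v i) W ^ 2 ≤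
      (8 * Real.exp (-(α * J)) ^ 2 + 2 * Y ^ 2) * (lam i₁ ^ J) ^ 2 := by
    set E := Real.exp (-(α * J))
    calc _ = ∑ i ∈ (Finset.univ.erase i₀).erase i₁, (a * inner ℝ (v i) W) ^ 2 := by
          rw [Finset.mul_sum]; exact Finset.sum_congr rfl fun i _ => by ring
      _ ≤ ∑ i ∈ (Finset.univ.erase i₀).erase i₁,
          (2 * (lam i₁ ^ J * E) ^ 2 * a ^ 2 * inner ℝ (v i) g ^ 2 +
            2 * x ^ 2 * inner ℝ (v i) q ^ 2) := by
          refine Finset.sum_le_sum fun i hi => ?_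
          simp only [Finset.mem_erase] at hi
          rw [hWi]
          have h10 := hexp i hi.2.1 hi.1
          have h11 : (lam i ^ J) ^ 2 ≤ (lam i₁ ^ J * E) ^ 2 := by
            have := h0 i
            gcongr
          have h12 : 0 ≤ (a * inner ℝ (v i) g) ^ 2 := sq_nonneg _
          nlinarith [sq_nonneg (lam i ^ J * (a * inner ℝ (v i) g) - x * inner ℝ (v i) q)]
      _ = 2 * (lam i₁ ^ J * E) ^ 2 *
            (a ^ 2 * ∑ i ∈ (Finset.univ.erase i₀).erase i₁, inner ℝ (v i) g ^ 2) +
          2 * x ^ 2 * ∑ i ∈ (Finset.univ.erase i₀).erase i₁, inner ℝ (v i) q ^ 2 := by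
          rw [Finset.sum_add_distrib, ← Finset.mul_sum, ← Finset.mul_sum]; ring
      _ ≤ 2 * (lam i₁ ^ J * E) ^ 2 * 4 + 2 * (Y ^ 2 * (lam i₁ ^ J) ^ 2) * 1 := by
          have h13 : a ^ 2 * ∑ i ∈ (Finset.univ.erase i₀).erase i₁, inner ℝ (v i) g ^ 2 ≤ 4 := by
            calc _ ≤ a ^ 2 * ‖g‖ ^ 2 := by
                  gcongr; exact sum_erase_erase_le_norm_sq v i₀ i₁ g
              _ = (|a| * ‖g‖) ^ 2 := by rw [mul_pow, sq_abs]
              _ ≤ 2 ^ 2 := by gcongr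
              _ = 4 := by norm_num
          have h14 : ∑ i ∈ (Finset.univ.erase i₀).erase i₁, inner ℝ (v i) q ^ 2 ≤ 1 := by
            simpa [hn] using sum_erase_erase_le_norm_sq v i₀ i₁ q
          have h15 : 0 ≤ ∑ i ∈ (Finset.univ.erase i₀).erase i₁, inner ℝ (v i) q ^ 2 :=
            Finset.sum_nonneg fun i _ => sq_nonneg _
          gcongr
      _ = _ := by ring
  have hWne : W ≠ 0 := by
    intro h
    rw [h, inner_zero_right] at hW1
    have : 0 < p - Y := by linarith
    have : 0 < (lam i₁ ^ J) ^ 2 * (p - Y) ^ 2 := by positivity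
    nlinarith
  have fin := abs_sub_rayleigh_normalize_mul_le hA h0 hle1 hne hWne
  set M := |lam i₁ - rayleigh A (NormedSpace.normalize W)|
  have hM : 0 ≤ M := abs_nonneg _
  have hL2 : 0 < (lam i₁ ^ J) ^ 2 := by positivity
  refine le_of_mul_le_mul_left ?_ hL2
  calc (lam i₁ ^ J) ^ 2 * (M * (p - Y) ^ 2) = M * ((lam i₁ ^ J) ^ 2 * (p - Y) ^ 2) := by ring
    _ ≤ M * (a ^ 2 * inner ℝ (v i₁) W ^ 2) := by gcongr
    _ = a ^ 2 * (M * inner ℝ (v i₁) W ^ 2) := by ring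
    _ ≤ a ^ 2 * (inner ℝ (v i₀) W ^ 2 +
        ∑ i ∈ (Finset.univ.erase i₀).erase i₁, inner ℝ (v i) W ^ 2) := by gcongr
    _ ≤ _ := by linarith

/-- Error of the second eigenvalue estimate in terms of the starting vectors. -/
lemma abs_sub_secondEstimate_mul_le (hA : ∀ i, A.toEuclideanLin (v i) = lam i • v i)
    (h0 : ∀ i, 0 ≤ lam i) {i₀ i₁ : Fin d} (hne : i₁ ≠ i₀) (h1 : lam i₀ ≤ 1)
    (hlt : lam i₁ < lam i₀) (hpos : 0 < lam i₁) (hl : ∀ i, i ≠ i₀ → lam i ≤ lam i₁)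
    {α : ℝ} (hα : ∀ i, i ≠ i₀ → i ≠ i₁ → lam i ≤ lam i₁ - α)
    (hα0 : 0 < α) {q₀ w₀ : Vec d} (hq : ‖q₀‖ = 1) (hw : ‖w₀‖ = 1) {a T κ p Y : ℝ}
    (hadef : a = inner ℝ (v i₀) q₀) (ha : a ≠ 0) (hT0 : 0 ≤ T)
    (hT : T ^ 2 = (1 - a ^ 2) / a ^ 2) (hκ : κ = lam i₁ / lam i₀)
    (hp : p = |a * inner ℝ (v i₁) w₀ - inner ℝ (v i₀) w₀ * inner ℝ (v i₁) q₀|)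
    {m J : ℕ} (hJ : 2 * m + 1 ≤ J) (hm : 4 * T * κ ^ (m + 1) ≤ κ ^ 2)
    (hY : 8 * T * κ ^ J ≤ Y * κ) (hYp : Y < p) :
    |lam i₁ - secondEstimate A q₀ w₀ J| * (p - Y) ^ 2 ≤
      3 * Y ^ 2 + 8 * Real.exp (-(α * J)) ^ 2 := by
  have hpos0 : 0 < lam i₀ := hpos.trans hlt
  have hκ0 : 0 < κ := by rw [hκ]; positivity
  have hκ1 : κ < 1 := by rw [hκ, div_lt_one hpos0]; exact hlt
  have hle : ∀ i, lam i ≤ lam i₀ := fun i => by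
    by_cases hi : i = i₀
    · rw [hi]
    · exact (hl i hi).trans hlt.le
  have hle1 : ∀ i, lam i ≤ 1 := fun i => (hle i).trans h1
  set b : ℝ := inner ℝ (v i₀) w₀ with hb
  set g : Vec d := w₀ - (b / a) • q₀ with hgdef
  have hw' : w₀ = g + (b / a) • q₀ := by rw [hgdef]; abel
  have hg : inner ℝ (v i₀) g = 0 := by
    rw [hgdef, inner_sub_right, inner_smul_right, ← hadef, ← hb]; field_simp; ring
  have ha1 : |a| ≤ 1 := by
    have := inner_sq_le_norm_sq v i₀ q₀
    rw [hq, one_pow, ← hadef] at this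
    exact (sq_le_one_iff_abs_le_one a).1 this
  have hb1 : |b| ≤ 1 := by
    have := inner_sq_le_norm_sq v i₀ w₀
    rw [hw, one_pow, ← hb] at this
    exact (sq_le_one_iff_abs_le_one b).1 this
  have hgn : |a| * ‖g‖ ≤ 2 := by
    have e : a • g = a • w₀ - b • q₀ := by
      rw [hgdef, smul_sub, smul_smul, mul_div_cancel₀ _ ha]
    rw [← Real.norm_eq_abs, ← norm_smul, e]
    refine (norm_sub_le _ _).trans ?_
    rw [norm_smul, norm_smul, hq, hw, Real.norm_eq_abs, Real.norm_eq_abs]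
    linarith
  -- The cap at 1 controls the early steps, where T κ^j may be huge.
  let s : ℕ → ℝ := fun j => min 1 (T * κ ^ j)
  have hs0 : ∀ j, 0 ≤ s j := fun j => le_min zero_le_one (by positivity)
  have hqs : ∀ j, ∑ i ∈ Finset.univ.erase i₀,
      inner ℝ (v i) (preMomentum A q₀ w₀ j).1 ^ 2 ≤ s j ^ 2 := by
    intro j
    have hn := (preMomentum_fst hA hpos0 w₀ hq (hadef ▸ ha) j).1
    have b1 := sum_erase_le_norm_sq v i₀ (preMomentum A q₀ w₀ j).1
    have b2 := sum_erase_preMomentum_fst_le hA h0 hpos0 hl w₀ hq (hadef ▸ ha) j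
    have b3 := inner_sq_le_norm_sq v i₀ (preMomentum A q₀ w₀ j).1
    rw [hn, one_pow] at b1 b3
    rw [← hadef, ← hT, ← hκ] at b2
    rcases min_choice 1 (T * κ ^ j) with h | h
    · simp only [s, h]; linarith
    · simp only [s, h]
      rw [mul_pow]
      have : 0 ≤ T ^ 2 * (κ ^ j) ^ 2 := by positivity
      nlinarith
  obtain ⟨z, hz0, hW, hz⟩ := rawSecond_decomposition hA h0 hle hpos0 hq (hadef ▸ ha) hg hw' hs0 hqs
  have hYb : |a * z J| ≤ Y * lam i₁ ^ J := by
    -- Multiplying by a avoids dividing by a small overlap, as |a| ‖g‖ ≤ 2; the scale 2 λ₂^j then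
    -- turns the forcing term into 1 and λ₁/λ₂ into R.
    have key := damped_recursion (R := 1 / κ) (by rw [le_div_iff₀ hκ0]; linarith)
      (X := fun j => |a * z j| / (2 * lam i₁ ^ j)) (s := s) (fun j => by positivity) ?_ hs0
      (fun j => min_le_left _ _) ?_ (m := m) ?_ hJ
    · rw [div_le_iff₀ (by positivity)] at key
      refine key.trans ?_
      have h2 : 8 * s J / κ ≤ Y := by
        rw [div_le_iff₀ hκ0]
        have : s J ≤ T * κ ^ J := min_le_right _ _
        linarith
      calc _ = 8 * s J / κ * lam i₁ ^ J := by ring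
        _ ≤ _ := by gcongr
    · simp only [hz0, mul_div_cancel₀ _ ha, pow_zero]
      rw [div_le_one (by norm_num)]
      linarith
    · intro j
      rw [div_le_iff₀ (by positivity), abs_mul]
      have hgj := norm_pow_apply_le hA h0 hpos.le hl hg j
      have e : 1 / κ * lam i₁ = lam i₀ := by rw [hκ]; field_simp
      have h3 : |a| * ‖(A.toEuclideanLin ^ j) g‖ ≤ 2 * lam i₁ ^ j := by
        have : 0 < lam i₁ ^ j := by positivity
        calc _ ≤ |a| * (lam i₁ ^ j * ‖g‖) := by gcongr
          _ = lam i₁ ^ j * (|a| * ‖g‖) := by ring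
          _ ≤ lam i₁ ^ j * 2 := by gcongr
          _ = _ := by ring
      have hss := hs0 (j + 1)
      calc |a| * |z (j + 1)| ≤
            |a| * (lam i₀ * s (j + 1) * (|z j| + ‖(A.toEuclideanLin ^ j) g‖)) := by
            gcongr; exact hz j
        _ = lam i₀ * s (j + 1) * (|a * z j| + |a| * ‖(A.toEuclideanLin ^ j) g‖) := by
            rw [abs_mul]; ring
        _ ≤ lam i₀ * s (j + 1) * (|a * z j| + 2 * lam i₁ ^ j) := by gcongr
        _ = _ := by rw [← e, pow_succ]; field_simp
    · intro j hj
      have : s j ≤ T * κ ^ j := min_le_right _ _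
      have h4 : κ ^ j ≤ κ ^ (m + 1) := pow_le_pow_of_le_one hκ0.le hκ1.le hj
      have h5 : s j ≤ κ ^ 2 / 4 := by nlinarith
      calc 1 / κ * s j ≤ 1 / κ * (κ ^ 2 / 4) := by gcongr
        _ = _ := by field_simp
  have hn := (preMomentum_fst hA hpos0 w₀ hq (hadef ▸ ha) J).1
  change |lam i₁ - rayleigh A (preMomentum A q₀ w₀ J).2| * _ ≤ _
  rw [preMomentum_snd_eq A hw J]
  refine abs_sub_rayleigh_perturbed_mul_le hA h0 hne hle1 hpos hα hα0 hn hg hgn (fun i => ?_) hYb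
    ?_ hYp
  · rw [hW J, inner_add_right, inner_smul_right, inner_pow_apply hA]; ring
  · rw [hp, hgdef, inner_sub_right, inner_smul_right]
    congr 1
    field_simp

end SecondEstimate

/-! ### Numerical constants and rates. -/

lemma exp_neg_mul_le_inv_pow {α Q x : ℝ} (n : ℕ) (hα : 0 < α) (hQ : 0 < Q)
    (h : n * (1 / α * Real.log Q) ≤ x) : Real.exp (-(α * x)) ≤ Q⁻¹ ^ n := by
  have h1 : n * Real.log Q ≤ α * x := by
    calc n * Real.log Q = α * (n * (1 / α * Real.log Q)) := by field_simp
      _ ≤ α * x := by gcongr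
  calc Real.exp (-(α * x)) ≤ Real.exp (n * -Real.log Q) := by
        apply Real.exp_le_exp.2; linarith
    _ = Q⁻¹ ^ n := by rw [Real.exp_nat_mul, Real.exp_neg, Real.exp_log hQ]

lemma half_pow_small : (1 / 2 : ℝ) ^ 85 * (768 * 2 * 68 ^ 4) < 1 := by norm_num

lemma sixth_pow_small : (1 / 6 : ℝ) ^ 196 * (32 * 2 * 68 ^ 4) < 1 := by norm_num

/-- The accuracy reached is better than the target. -/
lemma error_budget {ρ τ d D u E Y2 p : ℝ} (hρ0 : 0 < ρ) (hρ : ρ < 1 / 2) (hτ : 1 < τ)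
    (hd : 3 ≤ d) (hD0 : 0 < D) (hDρ : D ≤ ρ) (hDd : D ^ 2 * (τ ^ 2 * d) ≤ 1)
    (hu0 : 0 ≤ u) (hu : u ^ 2 ≤ D) (hE0 : 0 ≤ E) (hE : E ≤ (ρ / (d * τ)) ^ 100)
    (hY : Y2 ≤ 64 * u ^ 195) (hp : (1 / (68 * d * τ)) ^ 2 ≤ p) :
    12 * Y2 + 32 * E ^ 2 < ρ ^ 2 * p ^ 2 := by
  have hu1 : u ≤ 1 := by nlinarith
  set G := d * τ with hG
  have hG3 : 3 ≤ G := by nlinarith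
  have hp2 : 1 / (68 ^ 4 * G ^ 4) ≤ p ^ 2 := by
    calc 1 / (68 ^ 4 * G ^ 4) = ((1 / (68 * d * τ)) ^ 2) ^ 2 := by
          rw [hG]; field_simp
      _ ≤ _ := by gcongr
  have h1 : 12 * Y2 < ρ ^ 2 * (1 / (68 ^ 4 * G ^ 4)) / 2 := by
    have h2 : u ^ 195 ≤ D ^ 97 := by
      calc u ^ 195 = (u ^ 2) ^ 97 * u := by ring
        _ ≤ D ^ 97 * 1 := by gcongr
        _ = _ := mul_one _
    have h3 : D ^ 8 * G ^ 4 ≤ 1 := by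
      have h4 : D ^ 2 * G ≤ 1 := by
        refine le_trans ?_ hDd
        rw [hG]
        have : d * τ ≤ τ ^ 2 * d := by nlinarith
        gcongr
      calc D ^ 8 * G ^ 4 = (D ^ 2 * G) ^ 4 := by ring
        _ ≤ 1 := pow_le_one₀ (by positivity) h4
    have h5 : D ^ 85 ≤ (1 / 2) ^ 85 := by gcongr; linarith
    -- Split 97 = 85 + 8 + 4: D^85 absorbs the numerical constant, D^8 absorbs G^4, and D^4 supplies
    -- ρ².
    have h6 : D ^ 97 * (768 * 2 * 68 ^ 4) * G ^ 4 < ρ ^ 2 := by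
      calc D ^ 97 * (768 * 2 * 68 ^ 4) * G ^ 4 =
            (D ^ 85 * (768 * 2 * 68 ^ 4)) * (D ^ 8 * G ^ 4) * (D ^ 2 * D ^ 2) := by ring
        _ ≤ ((1 / 2) ^ 85 * (768 * 2 * 68 ^ 4)) * 1 * (ρ ^ 2 * 1) := by
            have : D ^ 2 ≤ 1 := pow_le_one₀ hD0.le (by linarith)
            gcongr
        _ = ((1 / 2) ^ 85 * (768 * 2 * 68 ^ 4)) * ρ ^ 2 := by ring
        _ < 1 * ρ ^ 2 := by
            have := half_pow_small
            gcongr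
        _ = _ := one_mul _
    have h7 : 12 * Y2 ≤ 768 * D ^ 97 := by linarith
    refine h7.trans_lt ?_
    rw [mul_one_div, div_div, lt_div_iff₀ (by positivity)]
    linarith
  have h2 : 32 * E ^ 2 < ρ ^ 2 * (1 / (68 ^ 4 * G ^ 4)) / 2 := by
    have h3 : ρ / G ≤ 1 / 6 := by
      rw [div_le_iff₀ (by positivity)]; linarith
    have h4 : E ^ 2 ≤ (1 / 6) ^ 196 * (ρ ^ 2 / G ^ 4) := by
      calc E ^ 2 ≤ ((ρ / G) ^ 100) ^ 2 := by gcongr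
        _ = (ρ / G) ^ 196 * (ρ ^ 2 * ρ ^ 2 / G ^ 4) := by ring
        _ ≤ (1 / 6) ^ 196 * (ρ ^ 2 * 1 / G ^ 4) := by
            have : ρ ^ 2 ≤ 1 := pow_le_one₀ hρ0.le (by linarith)
            gcongr
        _ = _ := by rw [mul_one]
    calc 32 * E ^ 2 ≤ 32 * ((1 / 6) ^ 196 * (ρ ^ 2 / G ^ 4)) := by gcongr
      _ = ((1 / 6) ^ 196 * (32 * 2 * 68 ^ 4)) * (ρ ^ 2 * (1 / (68 ^ 4 * G ^ 4)) / 2) := by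
          field_simp
      _ < 1 * (ρ ^ 2 * (1 / (68 ^ 4 * G ^ 4)) / 2) := by
          have := sixth_pow_small
          gcongr
      _ = _ := one_mul _
  have h3 : ρ ^ 2 * (1 / (68 ^ 4 * G ^ 4)) ≤ ρ ^ 2 * p ^ 2 := by gcongr
  linarith

/-- Numerical consequences of the lower bound on the number of pre-momentum steps. -/
lemma rate_bounds {α₁ α₂ ρ τ d D κ T T2 p : ℝ} {J : ℕ} (hα₁ : 0 < α₁) (hα₂ : 0 < α₂)
    (hρ0 : 0 < ρ) (hρ : ρ < 1 / 2) (hτ : 1 < τ) (hd3 : 3 ≤ d) (hD0 : 0 < D) (hDρ : D ≤ ρ)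
    (hDα : D ≤ α₂) (hDd : D ^ 2 * (τ ^ 2 * d) ≤ 1) (hκ0 : 0 < κ) (hκ1 : κ < 1)
    (hακ : α₂ ≤ κ) (hκexp : κ ≤ Real.exp (-α₁)) (hT0 : 0 ≤ T) (hTsq : T ^ 2 = T2)
    (hT2e : √D ≤ T2) (hp : (1 / (68 * d * τ)) ^ 2 ≤ p)
    (hJ : 100 * (1 / α₁ * Real.log (T2 / D) + 1 / α₂ * Real.log (d * τ / ρ)) ≤ J) :
    0 < J ∧ 4 * T * κ ^ ((J - 1) / 2 + 1) ≤ κ ^ 2 ∧ T ^ 2 * (κ ^ J) ^ 2 ≤ 1 / 4 ∧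
      ∃ Y, 8 * T * κ ^ J ≤ Y * κ ∧ Y ≤ p / 2 ∧ 0 < p ∧
        12 * Y ^ 2 + 32 * Real.exp (-(α₂ * J)) ^ 2 < ρ ^ 2 * p ^ 2 := by
  obtain ⟨e, he⟩ : ∃ e, e = √D := ⟨_, rfl⟩
  rw [← he] at hT2e
  have he0 : 0 < e := he ▸ Real.sqrt_pos.2 hD0
  have he2 : e ^ 2 = D := he ▸ Real.sq_sqrt hD0.le
  have hT20 : 0 < T2 := he0.trans_le hT2e
  -- All rates are expressed in u = D/T2. The cap condition T2 ≥ √D gives u² ≤ D ≤ α₂ ≤ κ, so powers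
  -- of u pay for divisions by κ, while T2 · u = D ≤ 1 pays for the tangent.
  obtain ⟨u, hu⟩ : ∃ u, u = (T2 / D)⁻¹ := ⟨_, rfl⟩
  have hu0 : 0 < u := by rw [hu]; positivity
  have huD : u * T2 = D := by rw [hu]; field_simp
  have hue : u ≤ e := by
    by_contra h
    push Not at h
    have := mul_lt_mul h hT2e he0 hu0.le
    rw [huD, ← sq, he2] at this
    exact lt_irrefl _ this
  have hu2 : u ^ 2 ≤ D := by rw [← he2]; gcongr
  have hu2' : u ^ 2 ≤ 1 / 2 := by linarith
  have hu1 : u ≤ 1 := (pow_le_one_iff_of_nonneg hu0.le two_ne_zero).1 (by linarith)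
  have hT2u : T2 * u ≤ 1 := by rw [mul_comm]; linarith
  have hlogQ : 0 ≤ Real.log (T2 / D) := by
    apply Real.log_nonneg
    have := inv_anti₀ hu0 hu1
    rwa [inv_one, hu, inv_inv] at this
  have hlogd : 0 < Real.log (d * τ / ρ) := by
    apply Real.log_pos
    rw [one_lt_div hρ0]
    have : (3 : ℝ) * 1 ≤ d * τ := by gcongr
    linarith
  have hl1 : 0 ≤ 1 / α₁ * Real.log (T2 / D) := by positivity
  have hl2 : 0 < 1 / α₂ * Real.log (d * τ / ρ) := by positivity
  have hJpos : 0 < J := by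
    have : (0 : ℝ) < J := by linarith
    exact_mod_cast this
  have hκu : u ^ 2 ≤ κ := by linarith
  have hκJ : κ ^ J ≤ u ^ 100 := by
    calc κ ^ J ≤ Real.exp (-α₁) ^ J := by gcongr
      _ = Real.exp (-(α₁ * J)) := by rw [← Real.exp_nat_mul]; congr 1; ring
      _ ≤ u ^ 100 := by
          rw [hu]
          exact exp_neg_mul_le_inv_pow 100 hα₁ (by positivity) (by push_cast; linarith)
  have hE : Real.exp (-(α₂ * J)) ≤ (ρ / (d * τ)) ^ 100 := by
    have := exp_neg_mul_le_inv_pow (Q := d * τ / ρ) (x := J) 100 hα₂ (by positivity)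
      (by push_cast; linarith)
    rwa [inv_div] at this
  have hu90 : u ^ 90 * 16 ≤ 1 := by
    calc u ^ 90 * 16 = (u ^ 2) ^ 45 * 16 := by ring
      _ ≤ (1 / 2) ^ 45 * 16 := by gcongr
      _ ≤ 1 := by norm_num
  have hTκ : T ^ 2 * (κ ^ J) ^ 2 ≤ u ^ 199 := by
    calc T ^ 2 * (κ ^ J) ^ 2 ≤ T2 * (u ^ 100) ^ 2 := by rw [hTsq]; gcongr
      _ = T2 * u * u ^ 199 := by ring
      _ ≤ 1 * u ^ 199 := by gcongr
      _ = _ := one_mul _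
  -- With m = (J - 1)/2 rounded down, 2m + 1 ≤ J ≤ 2(m + 1), so the square of κ^(m+1) is at most
  -- κ^J.
  have hmκ : 4 * T * κ ^ ((J - 1) / 2 + 1) ≤ κ ^ 2 := by
    refine le_of_sq_le_sq ?_ (by positivity)
    have h2 : (κ ^ ((J - 1) / 2 + 1)) ^ 2 ≤ u ^ 100 := by
      rw [← pow_mul]
      exact (pow_le_pow_of_le_one hκ0.le hκ1.le (by omega)).trans hκJ
    calc (4 * T * κ ^ ((J - 1) / 2 + 1)) ^ 2 = 16 * T2 * (κ ^ ((J - 1) / 2 + 1)) ^ 2 := by rw [← hTsq]; ring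
      _ ≤ 16 * T2 * u ^ 100 := by gcongr
      _ = (T2 * u) * (u ^ 90 * 16) * u * (u ^ 2) ^ 4 := by ring
      _ ≤ 1 * 1 * 1 * κ ^ 4 := by gcongr
      _ = _ := by ring
  obtain ⟨Y, hY⟩ : ∃ Y, Y = 8 * T * κ ^ J / κ := ⟨_, rfl⟩
  have hY0 : 0 ≤ Y := by rw [hY]; positivity
  have hY2 : Y ^ 2 ≤ 64 * u ^ 195 := by
    rw [hY, div_pow, div_le_iff₀ (by positivity)]
    calc (8 * T * κ ^ J) ^ 2 = 64 * (T ^ 2 * (κ ^ J) ^ 2) := by ring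
      _ ≤ 64 * u ^ 199 := by gcongr
      _ = 64 * u ^ 195 * (u ^ 2) ^ 2 := by ring
      _ ≤ _ := by gcongr
  have hbudget := error_budget hρ0 hρ hτ hd3 hD0 hDρ hDd hu0.le hu2
    (Real.exp_nonneg _) hE hY2 hp
  have hp0 : 0 < p := lt_of_lt_of_le (by positivity) hp
  have hYp : Y ≤ p / 2 := by
    refine le_of_sq_le_sq ?_ (by positivity)
    have h2 : ρ ^ 2 ≤ 1 := pow_le_one₀ hρ0.le (by linarith)
    have h3 : ρ ^ 2 * p ^ 2 ≤ 1 * p ^ 2 := by gcongr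
    have h4 := sq_nonneg (Real.exp (-(α₂ * J)))
    rw [div_pow]
    linarith [sq_nonneg p]
  refine ⟨hJpos, hmκ, hTκ.trans ?_, Y, by rw [hY, div_mul_cancel₀ _ hκ0.ne'], hYp, hp0, hbudget⟩
  calc u ^ 199 = (u ^ 2) ^ 2 * u ^ 195 := by ring
    _ ≤ (1 / 2) ^ 2 * 1 := by
      have := pow_le_one₀ (n := 195) hu0.le hu1
      gcongr
    _ = _ := by norm_num

/-! ### The deterministic conclusion. -/

section Deterministic
variable {d : ℕ} {A : Matrix (Fin d) (Fin d) ℝ} {lam : Fin d → ℝ}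
  {v : OrthonormalBasis (Fin d) ℝ (Vec d)}

/-- The conclusion for all starting vectors in general position. -/
lemma conclusion_of_general_position (hd : 3 ≤ d)
    (hA : ∀ i, A.toEuclideanLin (v i) = lam i • v i)
    (h0 : ∀ i, 0 ≤ lam i) {i₀ i₁ : Fin d} (hne : i₁ ≠ i₀) (h1 : lam i₀ ≤ 1)
    (hl : ∀ i, i ≠ i₀ → lam i ≤ lam i₁)
    {α₁ α₂ ρ τ δ : ℝ} (hα₁ : 0 < α₁) (hα₁' : α₁ ≤ lam i₀ - lam i₁) (hα₂ : 0 < α₂)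
    (hα₂1 : α₂ ≤ lam i₁) (hα₂' : ∀ i, i ≠ i₀ → i ≠ i₁ → lam i ≤ lam i₁ - α₂)
    (hρ0 : 0 < ρ) (hρ : ρ < 1 / 2) (hρα : ρ ^ 2 < α₁) (hτ : 1 < τ)
    (hδ : δ = min ρ (1 / (τ * √d))) {q₀ w₀ : Vec d} (hq : ‖q₀‖ = 1) (hw : ‖w₀‖ = 1)
    (ha : inner ℝ (v i₀) q₀ ≠ 0)
    (hp : (1 / (68 * d * τ)) ^ 2 ≤
      |inner ℝ (v i₀) q₀ * inner ℝ (v i₁) w₀ - inner ℝ (v i₀) w₀ * inner ℝ (v i₁) q₀|)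
    (hcap : √(δ * α₂) ≤ 1 - inner ℝ (v i₀) q₀ ^ 2) {J : ℕ}
    (hJ : 100 * (1 / α₁ * Real.log (Real.tan (angle q₀ (v i₀)) ^ 2 / (δ * α₂)) +
      1 / α₂ * Real.log (d * τ / ρ)) ≤ J) :
    |lam i₁ - secondEstimate A q₀ w₀ J| < ρ ^ 2 ∧
      Tendsto (fun k => sinSq (momentumPhase A q₀ w₀ J k) (v i₀)) atTop (𝓝 0) := by
  obtain ⟨a, hadef⟩ : ∃ a : ℝ, a = inner ℝ (v i₀) q₀ := ⟨_, rfl⟩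
  rw [← hadef] at ha hp hcap
  obtain ⟨p, hpdef⟩ : ∃ p, p =
    |a * inner ℝ (v i₁) w₀ - inner ℝ (v i₀) w₀ * inner ℝ (v i₁) q₀| := ⟨_, rfl⟩
  rw [← hpdef] at hp
  have hd3 : (3 : ℝ) ≤ d := by exact_mod_cast hd
  have hpos1 : 0 < lam i₁ := hα₂.trans_le hα₂1
  have hlt : lam i₁ < lam i₀ := by linarith
  have hpos0 : 0 < lam i₀ := hpos1.trans hlt
  have hδ0 : 0 < δ := by rw [hδ]; exact lt_min hρ0 (by positivity)
  have hδρ : δ ≤ ρ := hδ ▸ min_le_left _ _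
  have hδd : δ ≤ 1 / (τ * √d) := hδ ▸ min_le_right _ _
  have hα₂le : α₂ ≤ 1 := by linarith
  obtain ⟨D, hD⟩ : ∃ D, D = δ * α₂ := ⟨_, rfl⟩
  rw [← hD] at hJ hcap
  have hD0 : 0 < D := by rw [hD]; positivity
  have hDδ : D ≤ δ := hD ▸ mul_le_of_le_one_right hδ0.le hα₂le
  have hDα : D ≤ α₂ := hD ▸ mul_le_of_le_one_left hα₂.le (by linarith)
  have hDd : D ^ 2 * (τ ^ 2 * d) ≤ 1 := by
    have h2 : D * (τ * √d) ≤ 1 := by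
      rw [← le_div_iff₀ (by positivity)]; exact hDδ.trans hδd
    have h3 : √(d : ℝ) ^ 2 = d := Real.sq_sqrt (by positivity)
    calc D ^ 2 * (τ ^ 2 * d) = (D * (τ * √d)) ^ 2 := by rw [mul_pow, mul_pow, h3]
      _ ≤ 1 := pow_le_one₀ (by positivity) h2
  have ha2 : 0 < a ^ 2 := by positivity
  have ha2' : a ^ 2 ≤ 1 := by simpa [hq, hadef] using inner_sq_le_norm_sq v i₀ q₀
  obtain ⟨T2, hT2⟩ : ∃ T2, T2 = (1 - a ^ 2) / a ^ 2 := ⟨_, rfl⟩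
  have hT2e : √D ≤ T2 := by
    rw [hT2, le_div_iff₀ ha2]
    exact (mul_le_of_le_one_right (Real.sqrt_nonneg D) ha2').trans hcap
  have hT20 : 0 < T2 := (Real.sqrt_pos.2 hD0).trans_le hT2e
  have htan : Real.tan (angle q₀ (v i₀)) ^ 2 = T2 := by
    rw [angle, Real.tan_arccos, div_pow, sq_abs, real_inner_comm, ← hadef, Real.sq_sqrt, ← hT2]
    linarith
  rw [htan] at hJ
  obtain ⟨κ, hκ⟩ : ∃ κ, κ = lam i₁ / lam i₀ := ⟨_, rfl⟩
  have hκ0 : 0 < κ := by rw [hκ]; positivity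
  have hκ1 : κ < 1 := by rw [hκ, div_lt_one hpos0]; exact hlt
  have hακ : α₂ ≤ κ := by
    rw [hκ, le_div_iff₀ hpos0]
    exact (mul_le_of_le_one_right hα₂.le h1).trans hα₂1
  have hκexp : κ ≤ Real.exp (-α₁) := by
    refine le_trans ?_ (Real.add_one_le_exp (-α₁))
    have h2 := mul_le_of_le_one_right hα₁.le h1
    rw [hκ, div_le_iff₀ hpos0, add_mul, neg_mul]
    linarith
  have hTsq : √T2 ^ 2 = T2 := Real.sq_sqrt hT20.le
  obtain ⟨hJpos, hmκ, hbasin, Y, hY, hYp, hp0, hbudget⟩ :=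
    rate_bounds hα₁ hα₂ hρ0 hρ hτ hd3 hD0 (hDδ.trans hδρ) hDα hDd hκ0 hκ1 hακ hκexp
      (Real.sqrt_nonneg T2) hTsq hT2e hp hJ
  have hmain := abs_sub_secondEstimate_mul_le hA h0 hne h1 hlt hpos1 hl hα₂' hα₂ hq hw hadef ha
    (Real.sqrt_nonneg T2) (hTsq.trans hT2) hκ hpdef (by omega) hmκ hY (by linarith)
  obtain ⟨μ, hμ⟩ : ∃ μ, μ = secondEstimate A q₀ w₀ J := ⟨_, rfl⟩
  rw [← hμ] at hmain ⊢
  have hμρ : |lam i₁ - μ| < ρ ^ 2 := by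
    by_contra h
    push Not at h
    -- Y ≤ p/2 costs a factor 4, which turns 3Y² + 8E² into the 12Y² + 32E² of the budget.
    have h2 : p ^ 2 / 4 ≤ (p - Y) ^ 2 := by
      calc p ^ 2 / 4 = (p / 2) ^ 2 := by ring
        _ ≤ _ := by gcongr; linarith
    have h3 : ρ ^ 2 * (p ^ 2 / 4) ≤ |lam i₁ - μ| * (p - Y) ^ 2 := by gcongr
    linarith
  refine ⟨hμρ, ?_⟩
  have hμ0 : 0 ≤ μ := hμ ▸ rayleigh_nonneg hA h0 _
  have hμ1 : μ ≤ lam i₀ := by linarith [neg_abs_le (lam i₁ - μ)]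
  have hβ : secondEstimate A q₀ w₀ J ^ 2 / 4 ≤ lam i₀ ^ 2 / 4 := by rw [← hμ]; gcongr
  refine momentumPair_tendsto hA h0 hpos0 h1 hκ1 (fun i hi => ?_) (by positivity)
    hβ (preMomentum_fst hA hpos0 w₀ hq (hadef ▸ ha) J).1 ?_
  · rw [hκ, div_mul_cancel₀ _ hpos0.ne']; exact hl i hi
  · refine (sum_erase_preMomentum_fst_le hA h0 hpos0 hl w₀ hq (hadef ▸ ha) J).trans ?_
    refine mul_le_mul_of_nonneg_right ?_ (sq_nonneg _)
    rw [← hadef, ← hT2, ← hTsq, ← hκ]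
    exact hbasin

end Deterministic

/-! ### Probability of bad starting vectors. -/

/-- Starting pairs that are not in general position are unlikely. -/
lemma prod_uniformSphere_bad_le {d N : ℕ} [NeZero d] (hd : 3 ≤ d) (hN : 0 < N)
    (v : OrthonormalBasis (Fin d) ℝ (Vec d)) (i₀ i₁ : Fin d) {ε : ℝ} (hε : 0 < ε)
    {S : Set (UnitSphere d × UnitSphere d)}
    (hS : ∀ q w : UnitSphere d, 1 / (4 * d * N) ≤ |inner ℝ (v i₀) (q : Vec d)| →
      1 / (4 * d * N) * ‖(inner ℝ (v i₀) (q : Vec d) : ℝ) • v i₁ -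
          (inner ℝ (v i₁) (q : Vec d) : ℝ) • v i₀‖ ≤
        |inner ℝ ((inner ℝ (v i₀) (q : Vec d) : ℝ) • v i₁ -
          (inner ℝ (v i₁) (q : Vec d) : ℝ) • v i₀) (w : Vec d)| →
      ε ≤ 1 - inner ℝ (v i₀) (q : Vec d) ^ 2 → (q, w) ∉ S) :
    (uniformSphere d).prod (uniformSphere d) S ≤
      ENNReal.ofReal (2 * (2 / N) + 2 * √2 * ε) := by
  let b : UnitSphere d → Vec d := fun q =>
    (inner ℝ (v i₀) (q : Vec d) : ℝ) • v i₁ - (inner ℝ (v i₁) (q : Vec d) : ℝ) • v i₀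
  let S₁ : Set (UnitSphere d) := {q | |inner ℝ (v i₀) (q : Vec d)| < 1 / (4 * d * N) * ‖v i₀‖}
  let S₂ : Set (UnitSphere d × UnitSphere d) :=
    {x | |inner ℝ (b x.1) (x.2 : Vec d)| < 1 / (4 * d * N) * ‖b x.1‖}
  let S₃ : Set (UnitSphere d) := {q | 1 - inner ℝ (v i₀) (q : Vec d) ^ 2 < ε}
  have hb : Continuous b := by fun_prop
  -- Monotonicity of the outer measure suffices, so measurability of S is not needed. In S₂ the slab
  -- direction depends on q, and its measure is found by fixing q and integrating.
  have hsub : S ⊆ S₁ ×ˢ Set.univ ∪ S₂ ∪ S₃ ×ˢ Set.univ := by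
    rintro ⟨q, w⟩ hqw
    by_contra h
    simp only [Set.mem_union, Set.mem_prod, Set.mem_univ, and_true, not_or] at h
    obtain ⟨⟨h1, h2⟩, h3⟩ := h
    refine hS q w ?_ (not_lt.1 h2) (not_lt.1 h3) hqw
    have h4 : 1 / (4 * d * N) * ‖v i₀‖ ≤ |inner ℝ (v i₀) (q : Vec d)| := not_lt.1 h1
    rwa [v.norm_eq_one, mul_one] at h4
  have hm₂ : MeasurableSet S₂ := by
    have h1 : Continuous fun x : UnitSphere d × UnitSphere d =>
        |inner ℝ (b x.1) (x.2 : Vec d)| := by fun_prop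
    have h2 : Continuous fun x : UnitSphere d × UnitSphere d =>
        1 / (4 * d * N) * ‖b x.1‖ := by fun_prop
    exact measurableSet_lt h1.measurable h2.measurable
  have h1 : (uniformSphere d).prod (uniformSphere d) (S₁ ×ˢ Set.univ) ≤
      ENNReal.ofReal (2 / N) := by
    rw [Measure.prod_prod, measure_univ, mul_one]
    exact uniformSphere_slab_le hN (v i₀)
  have h3 : (uniformSphere d).prod (uniformSphere d) (S₃ ×ˢ Set.univ) ≤
      ENNReal.ofReal (2 * √2 * ε) := by
    rw [Measure.prod_prod, measure_univ, mul_one]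
    exact uniformSphere_cap_le hd v i₀ hε
  have h2 : (uniformSphere d).prod (uniformSphere d) S₂ ≤ ENNReal.ofReal (2 / N) := by
    rw [Measure.prod_apply hm₂]
    calc _ ≤ ∫⁻ _ : UnitSphere d, ENNReal.ofReal (2 / N) ∂uniformSphere d :=
          lintegral_mono fun q => uniformSphere_slab_le hN (b q)
      _ = _ := by simp
  calc _ ≤ (uniformSphere d).prod (uniformSphere d)
        (S₁ ×ˢ Set.univ ∪ S₂ ∪ S₃ ×ˢ Set.univ) := measure_mono hsub
    _ ≤ ENNReal.ofReal (2 / N) + ENNReal.ofReal (2 / N) + ENNReal.ofReal (2 * √2 * ε) :=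
        (measure_union_le _ _).trans
          (add_le_add ((measure_union_le _ _).trans (add_le_add h1 h2)) h3)
    _ = _ := by
        rw [← ENNReal.ofReal_add (by positivity) (by positivity),
          ← ENNReal.ofReal_add (by positivity) (by positivity)]
        congr 1
        ring

/-- The left side is a constant times τ^{-1/2}, and the constant must go. For d ≥ 16384 the factor
d^{-1/4} in √D removes it; for τ ≥ 64 the smaller exponent does, since τ^{1/3} ≥ 4; otherwise both
terms on the right are at least 1/2 and the bound is trivial. -/
lemma min_one_failure_le {d : ℕ} (hd : 3 ≤ d) {τ D : ℝ} (hτ : 1 < τ) (hD0 : 0 ≤ D)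
    (hD : D ≤ 1 / (τ * √d)) :
    min 1 (1 / (4 * τ) + 2 * √2 * √D) ≤
      τ ^ (-(1 / 32768 : ℝ)) + Real.exp (-(1 / 32768 * d)) := by
  have hτ0 : 0 < τ := by linarith
  have hst : 1 < √τ := Real.lt_sqrt_of_sq_lt (by linarith)
  have hst2 : √τ ^ 2 = τ := Real.sq_sqrt hτ0.le
  have hinv : (1 / √τ) ^ 2 = 1 / τ := by rw [div_pow, hst2, one_pow]
  have hd3 : (3 : ℝ) ≤ d := by exact_mod_cast hd
  have hsd : 1 ≤ √(d : ℝ) := Real.one_le_sqrt.2 (by linarith)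
  have hy : (2 * √2 * √D) ^ 2 = 8 * D := by
    rw [mul_pow, mul_pow, Real.sq_sqrt hD0, Real.sq_sqrt (by norm_num)]; ring
  have hrp : τ ^ (-(1 / 2) : ℝ) = 1 / √τ := by
    rw [Real.rpow_neg hτ0.le, ← Real.sqrt_eq_rpow, one_div]
  have h4τ : 1 / (4 * τ) ≤ 1 / 4 * (1 / √τ) := by
    rw [← one_div_mul_one_div]
    have : √τ ≤ τ := by nlinarith
    gcongr
  by_cases hbig : 16384 ≤ d
  · have hsd' : 128 ≤ √(d : ℝ) := by
      refine Real.le_sqrt_of_sq_le ?_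
      have : (16384 : ℝ) ≤ d := by exact_mod_cast hbig
      linarith
    have h1 : 2 * √2 * √D ≤ 1 / 4 * (1 / √τ) := by
      refine le_of_sq_le_sq ?_ (by positivity)
      rw [hy, mul_pow, hinv]
      calc 8 * D ≤ 8 * (1 / (τ * √d)) := by gcongr
        _ ≤ 8 * (1 / (τ * 128)) := by gcongr
        _ = _ := by field_simp; norm_num
    calc _ ≤ 1 / (4 * τ) + 2 * √2 * √D := min_le_right _ _
      _ ≤ 1 / √τ := by
          have : 0 ≤ 1 / √τ := by positivity
          linarith
      _ = τ ^ (-(1 / 2) : ℝ) := hrp.symm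
      _ ≤ τ ^ (-(1 / 32768 : ℝ)) := Real.rpow_le_rpow_of_exponent_le hτ.le (by norm_num)
      _ ≤ _ := by linarith [Real.exp_pos (-(1 / 32768 * (d : ℝ)))]
  · by_cases hτ64 : 64 ≤ τ
    · have h1 : 2 * √2 * √D ≤ 3 * (1 / √τ) := by
        refine le_of_sq_le_sq ?_ (by positivity)
        rw [hy, mul_pow, hinv]
        calc 8 * D ≤ 8 * (1 / (τ * √d)) := by gcongr
          _ ≤ 8 * (1 / (τ * 1)) := by gcongr
          _ ≤ 9 * (1 / (τ * 1)) := by gcongr; norm_num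
          _ = _ := by rw [mul_one]; norm_num
      have h2 : (4 : ℝ) ≤ τ ^ (1 / 3 : ℝ) := by
        calc (4 : ℝ) = (64 : ℝ) ^ (1 / 3 : ℝ) := by
              rw [show (64 : ℝ) = 4 ^ (3 : ℝ) by norm_num, ← Real.rpow_mul (by norm_num)]
              norm_num
          _ ≤ _ := by gcongr
      calc _ ≤ 1 / (4 * τ) + 2 * √2 * √D := min_le_right _ _
        _ ≤ 4 * (1 / √τ) := by
            have : 0 ≤ 1 / √τ := by positivity
            linarith
        _ ≤ τ ^ (1 / 3 : ℝ) * τ ^ (-(1 / 2) : ℝ) := by rw [hrp]; gcongr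
        _ = τ ^ (-(1 / 6) : ℝ) := by rw [← Real.rpow_add hτ0]; norm_num
        _ ≤ τ ^ (-(1 / 32768 : ℝ)) := Real.rpow_le_rpow_of_exponent_le hτ.le (by norm_num)
        _ ≤ _ := by linarith [Real.exp_pos (-(1 / 32768 * (d : ℝ)))]
    · push Not at hτ64 hbig
      have hd' : (d : ℝ) ≤ 16384 := by exact_mod_cast hbig.le
      have h1 : 1 / 2 ≤ Real.exp (-(1 / 32768 * (d : ℝ))) := by
        have := Real.add_one_le_exp (-(1 / 32768 * (d : ℝ)))
        linarith
      have h2 : 1 / 2 ≤ τ ^ (-(1 / 32768 : ℝ)) := by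
        calc (1 / 2 : ℝ) = (64 : ℝ) ^ (-(1 / 6) : ℝ) := by
              rw [show (64 : ℝ) = 2 ^ (6 : ℝ) by norm_num, ← Real.rpow_mul (by norm_num)]
              norm_num [Real.rpow_neg_one]
          _ ≤ τ ^ (-(1 / 6) : ℝ) :=
              Real.rpow_le_rpow_of_nonpos hτ0 hτ64.le (by norm_num)
          _ ≤ _ := Real.rpow_le_rpow_of_exponent_le hτ.le (by norm_num)
      exact (min_le_left _ _).trans (by linarith)

end DMPower

/-! ### Assembly. -/

theorem mainTheorem3 :
    ∃ C c : ℝ, 0 < C ∧ 0 < c ∧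
      ∀ (d : ℕ) (hd : 3 ≤ d) (A : Matrix (Fin d) (Fin d) ℝ) (_ : A.PosSemidef)
        (lam : Fin d → ℝ) (_ : Antitone lam) (_ : lam ⟨0, by omega⟩ ≤ 1)
        (v : OrthonormalBasis (Fin d) ℝ (DMPower.Vec d))
        (_ : ∀ i, A.toEuclideanLin (v i) = lam i • v i)
        (α₁ α₂ ρ τ δ : ℝ)
        (_ : 0 < α₁) (_ : α₁ ≤ lam ⟨0, by omega⟩ - lam ⟨1, by omega⟩)
        (_ : 0 < α₂) (_ : α₂ ≤ lam ⟨1, by omega⟩ - lam ⟨2, by omega⟩)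
        (_ : 0 < ρ) (_ : ρ < min (1 / 2) (Real.sqrt α₁)) (_ : 1 < τ)
        (_ : δ = min ρ (1 / (τ * Real.sqrt d))),
        ((DMPower.uniformSphere d).prod (DMPower.uniformSphere d))
          {p : DMPower.UnitSphere d × DMPower.UnitSphere d |
            ¬ ∀ J : ℕ,
              C * (1 / α₁ *
                    Real.log (Real.tan (DMPower.angle (p.1 : DMPower.Vec d) (v ⟨0, by omega⟩)) ^ 2
                      / (δ * α₂))
                  + 1 / α₂ * Real.log (d * τ / ρ)) ≤ J →
              |lam ⟨1, by omega⟩ - DMPower.secondEstimate A p.1 p.2 J| < ρ ^ 2 ∧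
              Tendsto
                (fun k : ℕ =>
                  DMPower.sinSq (DMPower.momentumPhase A p.1 p.2 J k) (v ⟨0, by omega⟩))
                atTop (𝓝 0)}
          ≤ ENNReal.ofReal (τ ^ (-c) + Real.exp (-(c * d))) := by
  refine ⟨100, 1 / 32768, by norm_num, by norm_num, ?_⟩
  intro d hd A hpsd lam hanti hone v hA α₁ α₂ ρ τ δ hα₁ hα₁' hα₂ hα₂' hρ0 hρ hτ hδ
  have : NeZero d := ⟨by omega⟩
  have h0 := DMPower.eigenvalue_nonneg hpsd hA
  obtain ⟨hρ1, hρ2⟩ := lt_min_iff.1 hρ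
  have hρα : ρ ^ 2 < α₁ := (Real.lt_sqrt hρ0.le).1 hρ2
  have hd3 : (3 : ℝ) ≤ d := by exact_mod_cast hd
  have hτ0 : 0 < τ := by linarith
  have hδ0 : 0 < δ := by rw [hδ]; exact lt_min hρ0 (by positivity)
  have hD0 : 0 < δ * α₂ := by positivity
  generalize hi₀ : (⟨0, by omega⟩ : Fin d) = i₀ at *
  generalize hi₁ : (⟨1, by omega⟩ : Fin d) = i₁ at *
  have hne : i₁ ≠ i₀ := by rw [← hi₀, ← hi₁]; simp
  have hl : ∀ i, i ≠ i₀ → lam i ≤ lam i₁ := by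
    intro i hi
    refine hanti ?_
    rw [← hi₁, Fin.le_def]
    have : i.val ≠ 0 := fun h => hi (by rw [← hi₀]; exact Fin.ext h)
    simp only; omega
  have hl2 : ∀ i, i ≠ i₀ → i ≠ i₁ → lam i ≤ lam i₁ - α₂ := by
    intro i hi hi'
    have h1 : i.val ≠ 0 := fun h => hi (by rw [← hi₀]; exact Fin.ext h)
    have h2 : i.val ≠ 1 := fun h => hi' (by rw [← hi₁]; exact Fin.ext h)
    have : lam i ≤ lam ⟨2, by omega⟩ := hanti (by rw [Fin.le_def]; simp only; omega)
    linarith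
  have hα₂1 : α₂ ≤ lam i₁ := by linarith [h0 ⟨2, by omega⟩]
  -- N = ⌈16τ⌉ makes the two slab events cost at most 1/(4τ); N ≤ 17τ produces the constant 68 = 4 ·
  -- 17.
  have hN : 0 < ⌈16 * τ⌉₊ := Nat.ceil_pos.2 (by positivity)
  have hN' : (0 : ℝ) < ⌈16 * τ⌉₊ := by exact_mod_cast hN
  have hNle : (⌈16 * τ⌉₊ : ℝ) ≤ 17 * τ := by
    linarith [Nat.ceil_lt_add_one (show 0 ≤ 16 * τ by positivity)]
  have hNge : 16 * τ ≤ (⌈16 * τ⌉₊ : ℝ) := Nat.le_ceil _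
  have hbad := DMPower.prod_uniformSphere_bad_le hd hN v i₀ i₁
    (ε := √(δ * α₂)) (Real.sqrt_pos.2 hD0)
    (S := {p : DMPower.UnitSphere d × DMPower.UnitSphere d |
            ¬ ∀ J : ℕ,
              100 * (1 / α₁ *
                    Real.log (Real.tan (DMPower.angle (p.1 : DMPower.Vec d) (v i₀)) ^ 2
                      / (δ * α₂))
                  + 1 / α₂ * Real.log (d * τ / ρ)) ≤ J →
              |lam i₁ - DMPower.secondEstimate A p.1 p.2 J| < ρ ^ 2 ∧
              Tendsto
                (fun k : ℕ =>
                  DMPower.sinSq (DMPower.momentumPhase A p.1 p.2 J k) (v i₀))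
                atTop (𝓝 0)}) ?_
  · refine (le_min prob_le_one hbad).trans ?_
    rw [← ENNReal.ofReal_one, ← ENNReal.ofReal_min]
    refine ENNReal.ofReal_le_ofReal ?_
    have hD : δ * α₂ ≤ 1 / (τ * √d) := by
      have h1 : δ ≤ 1 / (τ * √d) := hδ ▸ min_le_right _ _
      exact (mul_le_of_le_one_right hδ0.le (by linarith)).trans h1
    refine le_trans ?_ (DMPower.min_one_failure_le hd hτ hD0.le hD)
    refine min_le_min_left _ (add_le_add_left ?_ _)
    calc 2 * (2 / (⌈16 * τ⌉₊ : ℝ)) ≤ 2 * (2 / (16 * τ)) := by gcongr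
      _ = 1 / (4 * τ) := by field_simp; norm_num
  · intro q w h1 h2 h3 hmem
    refine hmem fun J hJ => ?_
    have hq : ‖(q : DMPower.Vec d)‖ = 1 := by simp
    have hw : ‖(w : DMPower.Vec d)‖ = 1 := by simp
    have ht : 1 / (68 * d * τ) ≤ 1 / (4 * d * (⌈16 * τ⌉₊ : ℝ)) := by
      apply one_div_le_one_div_of_le (by positivity)
      calc 4 * d * (⌈16 * τ⌉₊ : ℝ) ≤ 4 * d * (17 * τ) := by gcongr
        _ = _ := by ring
    have ht0 : 0 < 1 / (68 * d * τ) := by positivity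
    refine DMPower.conclusion_of_general_position hd hA h0 hne hone hl hα₁ hα₁' hα₂ hα₂1 hl2
      hρ0 hρ1 hρα hτ hδ hq hw ?_ ?_ h3 hJ
    · intro h
      rw [h, abs_zero] at h1
      linarith
    · set a : ℝ := inner ℝ (v i₀) (q : DMPower.Vec d)
      set a' : ℝ := inner ℝ (v i₁) (q : DMPower.Vec d)
      -- The slab direction is no shorter than |a|, itself bounded below, which accounts for the
      -- square in the lower bound.
      have hb : |a| ≤ ‖a • v i₁ - a' • v i₀‖ := by
        have h4 := abs_real_inner_le_norm (a • v i₁ - a' • v i₀) (v i₁)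
        rw [inner_sub_left, inner_smul_left, inner_smul_left, v.inner_eq_one,
          v.inner_eq_zero hne.symm, v.norm_eq_one] at h4
        simpa using h4
      rw [inner_sub_left, inner_smul_left, inner_smul_left] at h2
      simp only [conj_trivial] at h2
      calc (1 / (68 * d * τ)) ^ 2 = 1 / (68 * d * τ) * (1 / (68 * d * τ)) := sq _
        _ ≤ 1 / (4 * d * (⌈16 * τ⌉₊ : ℝ)) * ‖a • v i₁ - a' • v i₀‖ := by
            gcongr
            exact ht.trans (h1.trans hb)
        _ ≤ _ := h2
        _ = _ := by rw [mul_comm a']
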